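/- **Theorem.** Setting. Let $d\ge 0$, let $M\cong\mathbb Z^{d+1}$ and $N=\mathrm{Hom}(M,\mathbb Z)$ be dual lattices, and let $\Delta\subset M_{\mathbb R}$ be an integral reflexive polytope: $\Delta$ is a lattice polytope with $0$ in its interior, and the dual polytope $\Delta^\vee=\{x\in N_{\mathbb R}:\langle m,x\rangle\le 1\ \forall m\in\mathrm{vertex}(\Delta)\}$ is a lattice polytope too. Let $\lambda(m)<0$ for $m\in\mathrm{vertex}(\Delta)$ and $\mu(n)<0$ for $n\in\mathrm{vertex}(\Delta^\vee)$ be arbitrary, and put $$\Delta_\lambda^\vee=\{x\in N_{\mathbb R}:\max_m(\langle x,m\rangle+\lambda(m))\le 0\},\qquad \Delta_\mu=\{p\in M_{\mathbb R}:\max_n(\langle p,n\rangle+\mu(n))\le 0\},$$ with faces $\Delta_m^\vee=\{x\in\partial\Delta_\lambda^\vee:\langle x,m\rangle=-\lambda(m)\}$ and $\Delta_n=\{p\in\partial\Delta_\mu:\langle p,n\rangle=-\mu(n)\}$. Let $dx$ and $dp$ be the Lebesgue measures on $\partial\Delta_\lambda^\vee$ and $\partial\Delta_\mu$ induced on each face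 by the lattice of integral vectors tangent to it, and let $|\cdot|$ denote the measures obtained from them by normalizing to total mass one (outer measures, when applied to non-measurable sets). For bounded $\psi$ on $\partial\Delta_\mu$ and bounded $\phi$ on $\partial\Delta_\lambda^\vee$ let $\psi^*(x)=\sup_{p\in\partial\Delta_\mu}(\langle x,p\rangle-\psi(p))$ and $\phi^*(p)=\sup_{x\in\partial\Delta_\lambda^\vee}(\langle x,p\rangle-\phi(x))$. Let $\mathcal P$ be the set of functions on $\partial\Delta_\lambda^\vee$ of the form $\psi^*$ with $\psi$ bounded, and let $\phi$ be a minimizer in $\mathcal P$ of $$\mathcal F(\phi)=\frac{1}{\int_{\partial\Delta_\lambda^\vee}dx}\int_{\partial\Delta_\lambda^\vee}\phi\,dx+\frac{1}{\int_{\partial\Delta_\mu}dp}\int_{\partial\Delta_\mu}\phi^*\,dp .$$ For $x\in\partial\Delta_\lambda^\vee$ let $\bar\nabla\phi(x)=\{p\in\partial\Delta_\mu:\phi^*(p)+\phi(x)=\langle x,p\rangle\}$ be the conjugate set, and let the gradient set $\nabla\phi(x)$ consist of those $p\in\bar\nabla\phi(x)$ that lie in $H_m^+=\bigcup\{\Delta_n:\langle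 n,m\rangle=1\}$ for every $m$ with $x\in\Delta_m^\vee$. Put $\nabla\phi(E)=\bigcup_{x\in E}\nabla\phi(x)$. The bad set $\mathcal B^\vee\subset\partial\Delta_\lambda^\vee$ consists of the $x$ which lie on some face $\Delta_m^\vee$ and have some $p\in\bar\nabla\phi(x)\setminus\nabla\phi(x)$ lying on a face $\Delta_n$ with $\langle m,n\rangle=0$. Define $\nabla\phi^*$ and the bad set $\mathcal B\subset\partial\Delta_\mu$ in the same way, with $\phi^*$ in place of $\phi$ and the roles of the two polytopes exchanged. Claim. The following conditions are equivalent: 1. $|\mathcal B|=0$; 2. $|\mathcal B^\vee|=0$; 3. the images $\nabla\phi(\partial\Delta_\lambda^\vee)\subset\partial\Delta_\mu$ and $\nabla\phi^*(\partial\Delta_\mu)\subset\partial\Delta_\lambda^\vee$ both have full measure. They hold if $\langle m,n\rangle\ne 0$ for all $m\in\mathrm{vertex}(\Delta)$ and $n\in\mathrm{vertex}(\Delta^\vee)$. When they hold: * $|\nabla\phi(E)|=|E|$ for every $E\subset\partial\Delta_\lambda^\vee$ and $|\nabla\phi^*(F)|=|F|$ for every $F\subset\partial\Delta_\mu$; these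 images are measurable (for the completed measures) if $E$, $F$ are. * $\nabla\phi$ and $\nabla\phi^*$ are mutually inverse modulo null sets: for a.e. $x$ there is $p$ with $\nabla\phi(x)=\{p\}$ and $\nabla\phi^*(p)=\{x\}$; for a.e. $p$ there is $x$ with $\nabla\phi^*(p)=\{x\}$ and $\nabla\phi(x)=\{p\}$; and $\nabla\phi^*(\nabla\phi(E))=E$, $\nabla\phi(\nabla\phi^*(F))=F$ up to null sets for all $E\subset\partial\Delta_\lambda^\vee$ and $F\subset\partial\Delta_\mu$. * On each open face $\mathrm{Int}(\Delta_m^\vee)$ (the points of $\Delta_m^\vee$ on no other face), in integral affine coordinates, $\phi$ is convex and solves $\det(D^2\phi)=C_0:=\int_{\partial\Delta_\mu}dp\big/\int_{\partial\Delta_\lambda^\vee}dx$ in the weak Alexandrov sense, that is, for each Borel subset $A$ the set of classical subgradients at the points of $A$ has Lebesgue measure $C_0$ times that of $A$. Likewise $\phi^*$ solves $\det(D^2\phi^*)=C_0^{-1}$ on each open face $\mathrm{Int}(\Delta_n)$. -/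

import Mathlib

open Set MeasureTheory

/-! Coordinates: `M = ℤ^(d+1)` and `N = Hom(M, ℤ) = ℤ^(d+1)`, so both real vector spaces are
`Fin (d+1) → ℝ`, and the duality pairing is the dot product `⬝ᵥ`. -/

/-- The vertices of a convex polytope: its extreme points. -/
def vertices {d : ℕ} (D : Set (Fin (d + 1) → ℝ)) : Set (Fin (d + 1) → ℝ) :=
  D.extremePoints ℝ

/-- The dual polytope `{x | ⟨m, x⟩ ≤ 1 for all vertices m}`. -/
def dualPolytope {d : ℕ} (D : Set (Fin (d + 1) → ℝ)) : Set (Fin (d + 1) → ℝ) :=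
  {x | ∀ m ∈ vertices D, m ⬝ᵥ x ≤ 1}

/-- A lattice polytope: the convex hull of finitely many integral points. -/
def IsIntegralPolytope {d : ℕ} (D : Set (Fin (d + 1) → ℝ)) : Prop :=
  ∃ S : Finset (Fin (d + 1) → ℤ),
    D = convexHull ℝ ((fun (v : Fin (d + 1) → ℤ) (i : Fin (d + 1)) => (v i : ℝ)) '' (S : Set _))

/-- An integral reflexive polytope: a lattice polytope with the origin in its interior, whose dual
polytope is a lattice polytope as well. -/
structure IsReflexivePolytope {d : ℕ} (D : Set (Fin (d + 1) → ℝ)) : Prop where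
  integral : IsIntegralPolytope D
  zero_mem_interior : (0 : Fin (d + 1) → ℝ) ∈ interior D
  integral_dual : IsIntegralPolytope (dualPolytope D)

/-- A set of normal vectors `v` with weights `w v`, describing `{x | max_v (⟨x, v⟩ + w v) ≤ 0}`. -/
structure WeightedNormals (d : ℕ) where
  normals : Set (Fin (d + 1) → ℝ)
  weight : (Fin (d + 1) → ℝ) → ℝ

/-- The normals (vertices of `Δ`) and weights (`lam`) defining `Δ_λ^∨` in `N_ℝ`. -/
def nSide {d : ℕ} (D : Set (Fin (d + 1) → ℝ)) (lam : (Fin (d + 1) → ℝ) → ℝ) :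
    WeightedNormals d := ⟨vertices D, lam⟩

/-- The normals (vertices of `Δ^∨`) and weights (`mu`) defining `Δ_μ` in `M_ℝ`. -/
def mSide {d : ℕ} (D : Set (Fin (d + 1) → ℝ)) (mu : (Fin (d + 1) → ℝ) → ℝ) :
    WeightedNormals d := ⟨vertices (dualPolytope D), mu⟩

/-- The integral vectors orthogonal to `v`. -/
def normalLattice {d : ℕ} (v : Fin (d + 1) → ℝ) : Submodule ℤ (Fin (d + 1) → ℤ) :=
  LinearMap.ker (Fintype.linearCombination ℤ v)

/-- The index type of integral affine coordinates on a hyperplane with normal `v`. It has `d`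
elements if `v` is a nonzero integral vector. -/
abbrev CoordIndex {d : ℕ} (v : Fin (d + 1) → ℝ) : Type :=
  Module.Free.ChooseBasisIndex ℤ (normalLattice v)

/-- A `ℤ`-basis of the lattice of integral vectors orthogonal to `v`, as real vectors. -/
noncomputable def coordVector {d : ℕ} (v : Fin (d + 1) → ℝ) (i : CoordIndex v) :
    Fin (d + 1) → ℝ :=
  fun j => (((Module.Free.chooseBasis ℤ (normalLattice v) i : normalLattice v) :
    Fin (d + 1) → ℤ) j : ℝ)

namespace WeightedNormals

variable {d : ℕ}

/-- The polytope `{x | max_v (⟨x, v⟩ + w v) ≤ 0}`. -/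
def body (P : WeightedNormals d) : Set (Fin (d + 1) → ℝ) :=
  {x | ∀ v ∈ P.normals, x ⬝ᵥ v + P.weight v ≤ 0}

/-- The boundary of the polytope. -/
def boundary (P : WeightedNormals d) : Set (Fin (d + 1) → ℝ) := frontier P.body

/-- The face with normal `v`. -/
def face (P : WeightedNormals d) (v : Fin (d + 1) → ℝ) : Set (Fin (d + 1) → ℝ) :=
  {x ∈ P.boundary | x ⬝ᵥ v = -P.weight v}

/-- The open face with normal `v`: the points of the boundary that lie on this face only. -/
def openFace (P : WeightedNormals d) (v : Fin (d + 1) → ℝ) : Set (Fin (d + 1) → ℝ) :=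
  {x ∈ P.face v | ∀ v' ∈ P.normals, x ∈ P.face v' → v' = v}

/-- Integral affine coordinates on the hyperplane `⟨x, v⟩ = -w v`: a point of this hyperplane plus
a real combination of a `ℤ`-basis of the integral vectors tangent to it. -/
noncomputable def chart (P : WeightedNormals d) (v : Fin (d + 1) → ℝ) (t : CoordIndex v → ℝ) :
    Fin (d + 1) → ℝ :=
  (-P.weight v / (v ⬝ᵥ v)) • v + ∑ i, t i • coordVector v i

/-- The Lebesgue measure on the face with normal `v`, induced by the integral structure: a
fundamental cell of the lattice of integral vectors tangent to the face has mass one. -/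
noncomputable def faceMeasure (P : WeightedNormals d) (v : Fin (d + 1) → ℝ) :
    Measure (Fin (d + 1) → ℝ) :=
  (Measure.map (P.chart v) volume).restrict (P.face v)

/-- The canonical Lebesgue measure on the boundary (as a measure on the ambient space). -/
noncomputable def boundaryMeasure (P : WeightedNormals d) : Measure (Fin (d + 1) → ℝ) :=
  Measure.sum fun v : P.normals => P.faceMeasure v

/-- The canonical Lebesgue measure on the boundary, normalized to total mass one. -/
noncomputable def probMeasure (P : WeightedNormals d) : Measure (Fin (d + 1) → ℝ) :=
  (P.boundaryMeasure univ)⁻¹ • P.boundaryMeasure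

/-- The Legendre transform of a function on the boundary of `P`. The formula also provides the
canonical extension of the transform to the whole vector space. Only the values of `f` on
`P.boundary` matter, here and in all definitions below. -/
noncomputable def legendre (P : WeightedNormals d) (f : (Fin (d + 1) → ℝ) → ℝ)
    (y : Fin (d + 1) → ℝ) : ℝ :=
  ⨆ x : P.boundary, ((x : Fin (d + 1) → ℝ) ⬝ᵥ y - f x)

/-- The class of global convex functions on the boundary of `P`: the Legendre transforms of bounded
functions on the boundary of `Q`. -/
def IsGlobalConvex (P Q : WeightedNormals d) (φ : (Fin (d + 1) → ℝ) → ℝ) : Prop :=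
  ∃ ψ : (Fin (d + 1) → ℝ) → ℝ, (∃ C : ℝ, ∀ p ∈ Q.boundary, |ψ p| ≤ C) ∧
    ∀ x ∈ P.boundary, φ x = Q.legendre ψ x

/-- The functional `∫ φ dL^∨ + ∫ φ* dL`. -/
noncomputable def functional (P Q : WeightedNormals d) (φ : (Fin (d + 1) → ℝ) → ℝ) : ℝ :=
  ∫ x, φ x ∂P.probMeasure + ∫ p, P.legendre φ p ∂Q.probMeasure

/-- `φ` minimizes the functional in the class of global convex functions. -/
def IsMinimizer (P Q : WeightedNormals d) (φ : (Fin (d + 1) → ℝ) → ℝ) : Prop :=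
  IsGlobalConvex P Q φ ∧ ∀ φ', IsGlobalConvex P Q φ' → functional P Q φ ≤ functional P Q φ'

/-- The conjugate set of `φ` at `x`. -/
def conjugateSet (P Q : WeightedNormals d) (φ : (Fin (d + 1) → ℝ) → ℝ) (x : Fin (d + 1) → ℝ) :
    Set (Fin (d + 1) → ℝ) :=
  {p ∈ Q.boundary | P.legendre φ p + φ x = x ⬝ᵥ p}

/-- For a normal `m` of the other polytope, the union `H_m^+` of the faces of `Q` whose normal `n`
satisfies `⟨n, m⟩ = 1`. -/
def posFaces (Q : WeightedNormals d) (m : Fin (d + 1) → ℝ) : Set (Fin (d + 1) → ℝ) :=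
  {p | ∃ n ∈ Q.normals, n ⬝ᵥ m = 1 ∧ p ∈ Q.face n}

/-- The gradient set of `φ` at `x`. -/
def gradientSet (P Q : WeightedNormals d) (φ : (Fin (d + 1) → ℝ) → ℝ) (x : Fin (d + 1) → ℝ) :
    Set (Fin (d + 1) → ℝ) :=
  {p ∈ conjugateSet P Q φ x | ∀ m ∈ P.normals, x ∈ P.face m → p ∈ Q.posFaces m}

/-- The image of `E` under the gradient: the union of the gradient sets of the points of `E`. -/
def gradientImage (P Q : WeightedNormals d) (φ : (Fin (d + 1) → ℝ) → ℝ)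
    (E : Set (Fin (d + 1) → ℝ)) : Set (Fin (d + 1) → ℝ) :=
  {p | ∃ x ∈ E, p ∈ gradientSet P Q φ x}

/-- The bad set of `φ` in the boundary of `P`: the points `x` of some face with normal `m` which have
an anomalous conjugate point (one that is not a gradient) on a face of `Q` with normal `n`
orthogonal to `m`. -/
def badSet (P Q : WeightedNormals d) (φ : (Fin (d + 1) → ℝ) → ℝ) : Set (Fin (d + 1) → ℝ) :=
  {x | ∃ m ∈ P.normals, x ∈ P.face m ∧ ∃ n ∈ Q.normals, m ⬝ᵥ n = 0 ∧
    ∃ p ∈ Q.face n, p ∈ conjugateSet P Q φ x \ gradientSet P Q φ x}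

end WeightedNormals

/-- The union over `t ∈ A` of the classical subdifferentials at `t` of a function `u` on `U`. -/
def subgradientImage {ι : Type} [Fintype ι] (U : Set (ι → ℝ)) (u : (ι → ℝ) → ℝ)
    (A : Set (ι → ℝ)) : Set (ι → ℝ) :=
  {ξ | ∃ t ∈ A, ∀ s ∈ U, u t + ξ ⬝ᵥ (s - t) ≤ u s}

/-- `u` is a convex function on the open convex set `U` and solves `det (D²u) = c` there in the weak
sense of Alexandrov: the Monge-Ampère measure of `u` is `c` times Lebesgue measure. -/
def IsAlexandrovSolution {ι : Type} [Fintype ι] (U : Set (ι → ℝ)) (u : (ι → ℝ) → ℝ)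
    (c : ENNReal) : Prop :=
  IsOpen U ∧ ConvexOn ℝ U u ∧
    ∀ A ⊆ U, MeasurableSet A →
      NullMeasurableSet (subgradientImage U u A) volume ∧
      volume (subgradientImage U u A) = c * volume A

/-- `φ` solves `det (D²φ) = c` in the weak sense of Alexandrov on the open face with normal `v`, in
integral affine coordinates. -/
def WeightedNormals.SolvesMongeAmpereOnFace {d : ℕ} (P : WeightedNormals d)
    (φ : (Fin (d + 1) → ℝ) → ℝ) (c : ENNReal) (v : Fin (d + 1) → ℝ) : Prop :=
  IsAlexandrovSolution {t : CoordIndex v → ℝ | P.chart v t ∈ P.openFace v}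
    (fun t => φ (P.chart v t)) c

/-! Replacing `φ` by its double Legendre transform gives a conjugate pair `f`, `g` of convex
Lipschitz functions on the whole spaces. By Rademacher, almost every `x` lies on a single face `m`
and all its conjugate points lie on one line in direction `m`. Conjugacy persists in direction `+m`,
so it reaches the point where the line leaves the body of `Q`. That exit point lies in `H_m^+`,
which the line meets only once, so the gradient at `x` is a single point `T x`. Likewise there is a
gradient `S p` at almost every `p`; both maps can be taken Borel, and they invert each other where
both are regular (`swap`).

Lowering `g` on a compact set and using minimality shows that a set of points `p` has at most the
measure of the set of points conjugate to it (`measure_le_conj`). If a conjugate pair of regular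
points on faces `m`, `n` is not a gradient pair, then `⟨m, n⟩` is an integer less than one. The
value zero is what the bad set records. If `⟨m, n⟩ ≤ -1`, projection along `n` maps the entry face
`m` and an exit face to the same Euclidean space, expanding measure by at least one on the entry
face and preserving it on the exit face. Taking a strict Hahn decomposition of `dx` and the image
measure `S_* dp`, this comparison on both sides shows that negative pairs across the decomposition
are negligible (`measure_negative_pairs`). So a null bad set forces `S_* dp = dx` (`map_eq`), hence
also `T_* dx = dp`.

The measure and inversion statements follow from the two transport identities. Since `g` minimizes
the dual functional, either bad set may be used as the starting point; conversely, full gradient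
images leave no room for bad regular points.

For the Monge-Ampère equation, the classical subgradients on an open face are the gradients
projected along `m` (`subgradientImage_eq`). That projection is injective and measure preserving on
`H_m^+` (`volume_lineProj_image_posFaces`), by a determinant computation for orthogonal lattices
(`abs_det_pairing`). -/

namespace WeightedNormals

/-! ### Dual pairs of weighted normals and the faces they cut out. -/

variable {d : ℕ}

/-- The combinatorial properties of the vertices of a reflexive polytope and of its dual, together
with the boundedness of the polytopes that they cut out. -/
structure IsDualPair (P Q : WeightedNormals d) : Prop where
  finite_left : P.normals.Finite
  finite_right : Q.normals.Finite
  integral_left : ∀ m ∈ P.normals, ∃ z : Fin (d + 1) → ℤ, m = fun i => (z i : ℝ)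
  integral_right : ∀ n ∈ Q.normals, ∃ z : Fin (d + 1) → ℤ, n = fun i => (z i : ℝ)
  dot_le_one : ∀ m ∈ P.normals, ∀ n ∈ Q.normals, m ⬝ᵥ n ≤ 1
  exists_dot_eq_one_left : ∀ m ∈ P.normals, ∃ n ∈ Q.normals, m ⬝ᵥ n = 1
  exists_dot_eq_one_right : ∀ n ∈ Q.normals, ∃ m ∈ P.normals, m ⬝ᵥ n = 1
  weight_neg_left : ∀ m ∈ P.normals, P.weight m < 0
  weight_neg_right : ∀ n ∈ Q.normals, Q.weight n < 0
  bounded_left : Bornology.IsBounded P.body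
  bounded_right : Bornology.IsBounded Q.body
  nonempty_left : P.normals.Nonempty
  nonempty_right : Q.normals.Nonempty

namespace IsDualPair

variable {P Q : WeightedNormals d}

theorem symm (h : IsDualPair P Q) : IsDualPair Q P where
  finite_left := h.finite_right
  finite_right := h.finite_left
  integral_left := h.integral_right
  integral_right := h.integral_left
  dot_le_one := fun n hn m hm => by rw [dotProduct_comm]; exact h.dot_le_one m hm n hn
  exists_dot_eq_one_left := fun n hn => by
    simpa only [dotProduct_comm] using h.exists_dot_eq_one_right n hn
  exists_dot_eq_one_right := fun m hm => by
    simpa only [dotProduct_comm] using h.exists_dot_eq_one_left m hm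
  weight_neg_left := h.weight_neg_right
  weight_neg_right := h.weight_neg_left
  bounded_left := h.bounded_right
  bounded_right := h.bounded_left
  nonempty_left := h.nonempty_right
  nonempty_right := h.nonempty_left

theorem exists_int_dot (h : IsDualPair P Q) {m n : Fin (d + 1) → ℝ} (hm : m ∈ P.normals)
    (hn : n ∈ Q.normals) : ∃ k : ℤ, m ⬝ᵥ n = k ∧ k ≤ 1 := by
  obtain ⟨z, rfl⟩ := h.integral_left m hm
  obtain ⟨w, rfl⟩ := h.integral_right n hn
  refine ⟨z ⬝ᵥ w, by simp [dotProduct], ?_⟩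
  have := h.dot_le_one _ hm _ hn
  have e : ((z ⬝ᵥ w : ℤ) : ℝ) ≤ ((1 : ℤ) : ℝ) := by simpa [dotProduct] using this
  exact_mod_cast e

theorem dot_eq_one_of_pos (h : IsDualPair P Q) {m n : Fin (d + 1) → ℝ} (hm : m ∈ P.normals)
    (hn : n ∈ Q.normals) (hpos : 0 < m ⬝ᵥ n) : m ⬝ᵥ n = 1 := by
  obtain ⟨k, hk, hk1⟩ := h.exists_int_dot hm hn
  rw [hk] at hpos ⊢
  have : 0 < k := by exact_mod_cast hpos
  have : k = 1 := by omega
  simp [this]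

theorem dot_le_neg_one_of_neg (h : IsDualPair P Q) {m n : Fin (d + 1) → ℝ} (hm : m ∈ P.normals)
    (hn : n ∈ Q.normals) (hneg : m ⬝ᵥ n < 0) : m ⬝ᵥ n ≤ -1 := by
  obtain ⟨k, hk, hk1⟩ := h.exists_int_dot hm hn
  rw [hk] at hneg ⊢
  have : k < 0 := by exact_mod_cast hneg
  have : k ≤ -1 := by omega
  exact_mod_cast this

/-- Both vectors have largest pairing exactly one with the normals of `Q`, which leaves no room for
rescaling. -/
theorem eq_of_eq_smul (h : IsDualPair P Q) {m m' : Fin (d + 1) → ℝ} (hm : m ∈ P.normals)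
    (hm' : m' ∈ P.normals) {c : ℝ} (hc : 0 < c) (hmm : m' = c • m) : m' = m := by
  obtain ⟨n, hn, h1⟩ := h.exists_dot_eq_one_left m hm
  obtain ⟨n', hn', h1'⟩ := h.exists_dot_eq_one_left m' hm'
  have a := h.dot_le_one m' hm' n hn
  have b := h.dot_le_one m hm n' hn'
  rw [hmm, smul_dotProduct, h1, smul_eq_mul, mul_one] at a
  rw [hmm, smul_dotProduct, smul_eq_mul] at h1'
  have : c = 1 := by nlinarith
  rw [hmm, this, one_smul]

end IsDualPair

theorem continuous_dot (v : Fin (d + 1) → ℝ) : Continuous fun x : Fin (d + 1) → ℝ => x ⬝ᵥ v := by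
  unfold dotProduct; fun_prop

theorem isClosed_body (P : WeightedNormals d) : IsClosed P.body := by
  have : P.body = ⋂ v ∈ P.normals, {x | x ⬝ᵥ v + P.weight v ≤ 0} := by
    ext x; simp [body]
  rw [this]
  exact isClosed_biInter fun v _ => isClosed_le ((continuous_dot v).add continuous_const)
    continuous_const

theorem boundary_subset_body (P : WeightedNormals d) : P.boundary ⊆ P.body :=
  P.isClosed_body.frontier_subset

theorem isClosed_boundary (P : WeightedNormals d) : IsClosed P.boundary := isClosed_frontier

theorem isClosed_face (P : WeightedNormals d) (v : Fin (d + 1) → ℝ) : IsClosed (P.face v) :=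
  P.isClosed_boundary.inter (isClosed_eq (continuous_dot v) continuous_const)

namespace IsDualPair

variable {P Q : WeightedNormals d}

theorem mem_boundary_iff (h : IsDualPair P Q) {x : Fin (d + 1) → ℝ} :
    x ∈ P.boundary ↔ x ∈ P.body ∧ ∃ m ∈ P.normals, x ⬝ᵥ m = -P.weight m := by
  have hopen : IsOpen {x | ∀ v ∈ P.normals, x ⬝ᵥ v + P.weight v < 0} := by
    have : {x | ∀ v ∈ P.normals, x ⬝ᵥ v + P.weight v < 0} =
        ⋂ v ∈ P.normals, {x | x ⬝ᵥ v + P.weight v < 0} := by ext x; simp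
    rw [this]
    exact h.finite_left.isOpen_biInter fun v _ =>
      isOpen_lt ((continuous_dot v).add continuous_const) continuous_const
  constructor
  · intro hx
    refine ⟨P.boundary_subset_body hx, ?_⟩
    by_contra! hne
    have hint : x ∈ interior P.body := by
      refine mem_interior.2 ⟨_, fun y hy v hv => (hy v hv).le, hopen, fun v hv => ?_⟩
      have h1 := P.boundary_subset_body hx v hv
      exact lt_of_le_of_ne h1 fun h2 => hne v hv (by linarith)
    exact hx.2 hint
  · rintro ⟨hx, m, hm, he⟩
    refine ⟨subset_closure hx, fun hint => ?_⟩
    -- Moving in direction `n` increases the pairing with `m` at unit rate, so the body is left at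
    -- once.
    obtain ⟨n, -, hmn⟩ := h.exists_dot_eq_one_left m hm
    have hcont : Continuous fun s : ℝ => x + s • n := by fun_prop
    have hnear : ∀ᶠ s in nhds (0 : ℝ), x + s • n ∈ P.body := by
      have hb : P.body ∈ nhds (x + (0 : ℝ) • n) := by
        simpa using mem_interior_iff_mem_nhds.1 hint
      exact hcont.continuousAt.preimage_mem_nhds hb
    obtain ⟨ε, hε, hb⟩ := Metric.eventually_nhds_iff.1 hnear
    have := hb (y := ε / 2) (by rw [dist_zero_right, Real.norm_eq_abs, abs_of_pos] <;> linarith) m hm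
    rw [add_dotProduct, smul_dotProduct, he, dotProduct_comm n m, hmn, smul_eq_mul] at this
    linarith

theorem mem_face_iff (h : IsDualPair P Q) {m x : Fin (d + 1) → ℝ} (hm : m ∈ P.normals) :
    x ∈ P.face m ↔ x ∈ P.body ∧ x ⬝ᵥ m = -P.weight m := by
  constructor
  · exact fun hx => ⟨P.boundary_subset_body hx.1, hx.2⟩
  · exact fun hx => ⟨h.mem_boundary_iff.2 ⟨hx.1, m, hm, hx.2⟩, hx.2⟩

theorem exists_face (h : IsDualPair P Q) {x : Fin (d + 1) → ℝ} (hx : x ∈ P.boundary) :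
    ∃ m ∈ P.normals, x ∈ P.face m := by
  obtain ⟨_, m, hm, he⟩ := h.mem_boundary_iff.1 hx
  exact ⟨m, hm, hx, he⟩

theorem zero_mem_body (h : IsDualPair P Q) : (0 : Fin (d + 1) → ℝ) ∈ P.body := fun v hv => by
  simpa using (h.weight_neg_left v hv).le

theorem isCompact_body (h : IsDualPair P Q) : IsCompact P.body :=
  Metric.isCompact_of_isClosed_isBounded P.isClosed_body h.bounded_left

theorem isCompact_boundary (h : IsDualPair P Q) : IsCompact P.boundary :=
  h.isCompact_body.of_isClosed_subset P.isClosed_boundary P.boundary_subset_body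

theorem isCompact_face (h : IsDualPair P Q) (v : Fin (d + 1) → ℝ) : IsCompact (P.face v) :=
  h.isCompact_boundary.of_isClosed_subset (P.isClosed_face v) fun _ hx => hx.1

/-- A ray in the direction of a normal `m` of `P` that starts in the body of `Q` leaves it through
`Q.posFaces m`. -/
theorem exists_exit (h : IsDualPair P Q) {m p : Fin (d + 1) → ℝ} (hm : m ∈ P.normals)
    (hp : p ∈ Q.body) : ∃ s : ℝ, 0 ≤ s ∧ p + s • m ∈ Q.posFaces m := by
  obtain ⟨n₀, hn₀, h₀⟩ := h.exists_dot_eq_one_left m hm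
  have hfin : {n ∈ Q.normals | n ⬝ᵥ m = 1}.Finite := h.finite_right.subset (sep_subset _ _)
  -- For `⟨n, m⟩ = 1` the minimized quantity is the time at which the ray hits the hyperplane of
  -- `n`. By integrality every other normal has nonpositive pairing with `m`, so its inequality
  -- cannot be violated along the ray.
  obtain ⟨n, hn, hmin⟩ := hfin.toFinset.exists_min_image (fun n => -Q.weight n - p ⬝ᵥ n)
    ⟨n₀, by simpa [dotProduct_comm n₀] using ⟨hn₀, h₀⟩⟩
  rw [Finite.mem_toFinset] at hn
  have hs : 0 ≤ -Q.weight n - p ⬝ᵥ n := by linarith [hp n hn.1]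
  have hdot : m ⬝ᵥ n = 1 := by rw [dotProduct_comm]; exact hn.2
  refine ⟨_, hs, n, hn.1, hn.2, (h.symm.mem_face_iff hn.1).2 ⟨fun v hv => ?_, ?_⟩⟩
  · rw [add_dotProduct, smul_dotProduct, smul_eq_mul]
    rcases le_or_gt (m ⬝ᵥ v) 0 with h0 | h0
    · nlinarith [hp v hv]
    · have h1 := h.dot_eq_one_of_pos hm hv h0
      have := hmin v (by rw [Finite.mem_toFinset]; exact ⟨hv, by rw [dotProduct_comm]; exact h1⟩)
      rw [h1]; linarith
  · rw [add_dotProduct, smul_dotProduct, smul_eq_mul, hdot]; ring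

theorem posFaces_subset_boundary (Q : WeightedNormals d) (m : Fin (d + 1) → ℝ) :
    Q.posFaces m ⊆ Q.boundary := fun _ ⟨_, _, _, hp⟩ => hp.1

theorem posFaces_le (m : Fin (d + 1) → ℝ) {p : Fin (d + 1) → ℝ} {s : ℝ}
    (hp : p ∈ Q.posFaces m) (hp' : p + s • m ∈ Q.body) : s ≤ 0 := by
  obtain ⟨n, hn, hnm, hpn⟩ := hp
  have := hp' n hn
  rw [add_dotProduct, smul_dotProduct, hpn.2, dotProduct_comm, hnm, smul_eq_mul] at this
  linarith

/-- A line in direction `m` leaves the body at any point of `H_m^+`, so it has at most one such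
point. This makes gradients single valued and `lineProj m` injective on `H_m^+`. -/
theorem posFaces_unique (m : Fin (d + 1) → ℝ) {p p' : Fin (d + 1) → ℝ} {s : ℝ}
    (hp : p ∈ Q.posFaces m) (hp' : p' ∈ Q.posFaces m) (hs : p' = p + s • m) : p' = p := by
  have h1 : s ≤ 0 := posFaces_le m hp (by
    rw [← hs]; exact Q.boundary_subset_body (posFaces_subset_boundary Q m hp'))
  have h2 : -s ≤ 0 := posFaces_le m hp' (by
    rw [hs]; simpa using Q.boundary_subset_body (posFaces_subset_boundary Q m hp))
  have : s = 0 := by linarith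
  rw [hs, this]; simp

theorem isClosed_posFaces (h : IsDualPair P Q) (m : Fin (d + 1) → ℝ) :
    IsClosed (Q.posFaces m) := by
  have : Q.posFaces m = ⋃ n ∈ {n ∈ Q.normals | n ⬝ᵥ m = 1}, Q.face n := by
    ext p; simp [posFaces, and_assoc]
  rw [this]
  exact (h.finite_right.subset (sep_subset _ _)).isClosed_biUnion fun n _ => Q.isClosed_face n

theorem boundary_nonempty (h : IsDualPair P Q) : P.boundary.Nonempty := by
  obtain ⟨n, hn⟩ := h.nonempty_right
  obtain ⟨s, -, hs⟩ := h.symm.exists_exit hn h.zero_mem_body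
  exact ⟨_, posFaces_subset_boundary P n hs⟩

theorem weight_lt (h : IsDualPair P Q) {m : Fin (d + 1) → ℝ} (hm : m ∈ P.normals) :
    P.weight m < 0 := h.weight_neg_left m hm

end IsDualPair

end WeightedNormals

/-! ### Lattices orthogonal to a primitive vector, and the determinant of their pairing. -/

section Lattice

variable {d : ℕ}

/-- The integral vectors underlying `coordVector`. -/
noncomputable def latticeBasis (v : Fin (d + 1) → ℝ) (i : CoordIndex v) : Fin (d + 1) → ℤ :=
  ((Module.Free.chooseBasis ℤ (normalLattice v) i : normalLattice v) : Fin (d + 1) → ℤ)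

theorem coordVector_eq (v : Fin (d + 1) → ℝ) (i : CoordIndex v) :
    coordVector v i = fun j => (latticeBasis v i j : ℝ) := rfl

theorem mem_normalLattice {v : Fin (d + 1) → ℝ} {z y : Fin (d + 1) → ℤ}
    (hv : v = fun i => (z i : ℝ)) : y ∈ normalLattice v ↔ y ⬝ᵥ z = 0 := by
  rw [normalLattice, LinearMap.mem_ker, Fintype.linearCombination_apply, hv]
  have : ∑ i, y i • ((z i : ℤ) : ℝ) = ((y ⬝ᵥ z : ℤ) : ℝ) := by
    simp [dotProduct]
  rw [this]; norm_cast

theorem latticeBasis_dot {v : Fin (d + 1) → ℝ} {z : Fin (d + 1) → ℤ}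
    (hv : v = fun i => (z i : ℝ)) (i : CoordIndex v) : latticeBasis v i ⬝ᵥ z = 0 :=
  (mem_normalLattice hv).1 (Subtype.prop _)

theorem exists_latticeBasis_repr {v : Fin (d + 1) → ℝ} {z y : Fin (d + 1) → ℤ}
    (hv : v = fun i => (z i : ℝ)) (hy : y ⬝ᵥ z = 0) :
    ∃ a : CoordIndex v → ℤ, y = ∑ i, a i • latticeBasis v i := by
  let b := Module.Free.chooseBasis ℤ (normalLattice v)
  let y' : normalLattice v := ⟨y, (mem_normalLattice hv).2 hy⟩
  refine ⟨fun i => b.repr y' i, ?_⟩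
  have h := congrArg (Submodule.subtype _) (b.sum_repr y')
  rw [map_sum] at h
  exact h.symm

/-- The lattice is the kernel of a surjection from rank `d + 1` onto the integers. -/
theorem card_coordIndex {v : Fin (d + 1) → ℝ} {z y : Fin (d + 1) → ℤ}
    (hv : v = fun i => (z i : ℝ)) (hy : z ⬝ᵥ y = 1) : Fintype.card (CoordIndex v) = d := by
  rw [← Module.finrank_eq_card_chooseBasisIndex]
  let D : (Fin (d + 1) → ℤ) →ₗ[ℤ] ℤ := Fintype.linearCombination ℤ z
  have hD : ∀ x, D x = x ⬝ᵥ z := fun x => by simp [D, Fintype.linearCombination_apply, dotProduct]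
  have hker : normalLattice v = LinearMap.ker D := by
    ext x; rw [mem_normalLattice hv, LinearMap.mem_ker, hD]
  have hrange : LinearMap.range D = ⊤ := by
    rw [LinearMap.range_eq_top]
    intro k
    refine ⟨k • y, ?_⟩
    rw [hD, smul_dotProduct, dotProduct_comm, hy]; simp
  have h1 := Submodule.finrank_quotient_add_finrank (LinearMap.ker D)
  rw [(D.quotKerEquivOfSurjective (LinearMap.range_eq_top.1 hrange)).finrank_eq, ← hker] at h1
  simp at h1
  omega

variable {v w : Fin (d + 1) → ℝ}

/-- A `ℤ`-basis of the lattice orthogonal to `v`, completed by a vector `y`. -/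
noncomputable def completedBasis (v : Fin (d + 1) → ℝ) (e : CoordIndex v ≃ Fin d)
    (y : Fin (d + 1) → ℤ) (E : Fin d ⊕ Unit ≃ Fin (d + 1)) :
    Matrix (Fin d ⊕ Unit) (Fin d ⊕ Unit) ℤ :=
  Matrix.of fun r c => Sum.elim (fun i => latticeBasis v (e.symm i)) (fun _ => y) r (E c)

theorem isUnit_det_completedBasis {z y : Fin (d + 1) → ℤ}
    (hv : v = fun i => (z i : ℝ)) (hy : z ⬝ᵥ y = 1) (e : CoordIndex v ≃ Fin d)
    (E : Fin d ⊕ Unit ≃ Fin (d + 1)) : IsUnit (completedBasis v e y E).det := by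
  have hrep : ∀ j : Fin (d + 1), ∃ a : CoordIndex v → ℤ,
      (Pi.single j 1 - z j • y : Fin (d + 1) → ℤ) = ∑ i, a i • latticeBasis v i := fun j =>
    exists_latticeBasis_repr hv (by
      rw [sub_dotProduct, smul_dotProduct, dotProduct_comm y, hy]; simp)
  choose a ha using hrep
  -- The inverse matrix lists the coordinates of the unit vectors in the decomposition `e_j = (e_j -
  -- z_j y) + z_j y`, whose first summand is orthogonal to `z`.
  let W : Matrix (Fin d ⊕ Unit) (Fin d ⊕ Unit) ℤ :=
    Matrix.of fun r c => Sum.elim (fun i => a (E r) (e.symm i)) (fun _ => z (E r)) c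
  refine Matrix.isUnit_det_of_left_inverse (B := W) ?_
  ext r c
  have h := congrFun (ha (E r)) (E c)
  rw [Matrix.mul_apply, Fintype.sum_sum_type]
  simp only [W, completedBasis, Matrix.of_apply, Sum.elim_inl, Sum.elim_inr,
    Finset.univ_unique, Finset.sum_singleton]
  rw [e.symm.sum_comp (fun i => a (E r) i * latticeBasis v i (E c))]
  simp only [Pi.sub_apply, Pi.smul_apply, smul_eq_mul, Finset.sum_apply] at h
  rw [← h, Matrix.one_apply, Pi.single_apply]
  simp only [E.injective.eq_iff]
  have : (c = r) = (r = c) := propext eq_comm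
  simp only [this]; ring

/-- Modulo the lattice orthogonal to `z`, the vector `x` equals `⟨z, x⟩ y`; the lattice part does
not affect the determinant. -/
theorem det_completedBasis {z y x : Fin (d + 1) → ℤ}
    (hv : v = fun i => (z i : ℝ)) (hy : z ⬝ᵥ y = 1) (e : CoordIndex v ≃ Fin d)
    (E : Fin d ⊕ Unit ≃ Fin (d + 1)) :
    (completedBasis v e x E).det = (z ⬝ᵥ x) * (completedBasis v e y E).det := by
  obtain ⟨a, ha⟩ := exists_latticeBasis_repr (y := x - (z ⬝ᵥ x) • y) hv (by
    rw [sub_dotProduct, smul_dotProduct, dotProduct_comm y, hy, dotProduct_comm x]; simp)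
  let K : Matrix (Fin d ⊕ Unit) (Fin d ⊕ Unit) ℤ :=
    Matrix.fromBlocks 1 0 (Matrix.of fun _ i => a (e.symm i)) (Matrix.of fun _ _ => z ⬝ᵥ x)
  have hK : completedBasis v e x E = K * completedBasis v e y E := by
    ext r c
    rw [Matrix.mul_apply, Fintype.sum_sum_type]
    rcases r with r | r
    · simp [K, completedBasis, Matrix.one_apply]
    · simp only [K, completedBasis, Matrix.of_apply, Sum.elim_inl, Sum.elim_inr,
        Matrix.fromBlocks_apply₂₁, Matrix.fromBlocks_apply₂₂, Finset.univ_unique,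
        Finset.sum_singleton]
      rw [e.symm.sum_comp (fun i => a i * latticeBasis v i (E c))]
      have h := congrFun ha (E c)
      simp only [Pi.sub_apply, Pi.smul_apply, smul_eq_mul, Finset.sum_apply] at h
      rw [← h]; ring
  rw [hK, Matrix.det_mul, Matrix.det_fromBlocks_zero₁₂]
  simp

/-- Complete the basis orthogonal to `z` by `x` and the basis orthogonal to `x` by `z`. Each
completed basis has determinant `±⟨z, x⟩`, while the product of one with the transpose of the other
is block diagonal with blocks `A` and `⟨z, x⟩`. Hence `|det A| |⟨z, x⟩| = ⟨z, x⟩²`. -/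
theorem abs_det_pairing {z x zo xo : Fin (d + 1) → ℤ}
    (hv : v = fun i => (z i : ℝ)) (hw : w = fun i => (x i : ℝ))
    (hz : z ⬝ᵥ zo = 1) (hx : x ⬝ᵥ xo = 1) (hne : z ⬝ᵥ x ≠ 0)
    (e : CoordIndex v ≃ Fin d) (f : CoordIndex w ≃ Fin d) :
    |(Matrix.of fun i j => latticeBasis v (e.symm i) ⬝ᵥ latticeBasis w (f.symm j) :
      Matrix (Fin d) (Fin d) ℤ).det| = |z ⬝ᵥ x| := by
  set A := (Matrix.of fun i j => latticeBasis v (e.symm i) ⬝ᵥ latticeBasis w (f.symm j) :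
      Matrix (Fin d) (Fin d) ℤ)
  let E : Fin d ⊕ Unit ≃ Fin (d + 1) := Fintype.equivOfCardEq (by simp)
  have hprod : completedBasis v e x E * (completedBasis w f z E).transpose =
      Matrix.fromBlocks A 0 0 (Matrix.of fun _ _ => z ⬝ᵥ x) := by
    have key : ∀ p q : Fin (d + 1) → ℤ, ∑ c, p (E c) * q (E c) = p ⬝ᵥ q := fun p q =>
      E.sum_comp fun c => p c * q c
    ext r c
    rw [Matrix.mul_apply]
    rcases r with r | r <;> rcases c with c | c
    · simp only [completedBasis, Matrix.transpose_apply, Matrix.of_apply, Sum.elim_inl,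
        Matrix.fromBlocks_apply₁₁, A]
      exact key _ _
    · simp only [completedBasis, Matrix.transpose_apply, Matrix.of_apply, Sum.elim_inl,
        Matrix.fromBlocks_apply₁₂, Sum.elim_inr]
      rw [key, latticeBasis_dot hv]; rfl
    · simp only [completedBasis, Matrix.transpose_apply, Matrix.of_apply, Sum.elim_inl,
        Matrix.fromBlocks_apply₂₁, Sum.elim_inr]
      rw [key, dotProduct_comm, latticeBasis_dot hw]; rfl
    · simp only [completedBasis, Matrix.transpose_apply, Matrix.of_apply,
        Matrix.fromBlocks_apply₂₂, Sum.elim_inr]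
      rw [key, dotProduct_comm]
  have hdet := congrArg Matrix.det hprod
  rw [Matrix.det_mul, Matrix.det_transpose, Matrix.det_fromBlocks_zero₁₂,
    det_completedBasis (y := zo) hv hz, det_completedBasis (y := xo) hw hx] at hdet
  have h1 := Int.isUnit_iff_abs_eq.1 (isUnit_det_completedBasis hv hz e E)
  have h2 := Int.isUnit_iff_abs_eq.1 (isUnit_det_completedBasis hw hx f E)
  have habs := congrArg abs hdet
  simp only [abs_mul, h1, h2, Matrix.det_unique, Matrix.of_apply, mul_one,
    dotProduct_comm x z] at habs
  exact (mul_right_cancel₀ (abs_ne_zero.2 hne) habs).symm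

/-- Coordinates of `p` modulo the line spanned by `v`, dual to the integral affine coordinates on
the hyperplanes with normal `v`. -/
noncomputable def lineProj (v p : Fin (d + 1) → ℝ) : CoordIndex v → ℝ :=
  fun i => p ⬝ᵥ coordVector v i

/-- The linear part of an integral affine chart of a hyperplane with normal `w`, followed by the
projection along `v`. -/
noncomputable def pairingMap (v w : Fin (d + 1) → ℝ) : (CoordIndex w → ℝ) →ₗ[ℝ] (CoordIndex v → ℝ) :=
  Matrix.toLin' (Matrix.of fun i j => coordVector v i ⬝ᵥ coordVector w j)

/-- `v` is an integral vector that pairs to one with some integral vector. -/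
def IsPrimitiveVector (v : Fin (d + 1) → ℝ) : Prop :=
  ∃ z zo : Fin (d + 1) → ℤ, (v = fun i => (z i : ℝ)) ∧ z ⬝ᵥ zo = 1

theorem volume_pairingMap_image (hv : IsPrimitiveVector v) (hw : IsPrimitiveVector w)
    (hne : v ⬝ᵥ w ≠ 0) (s : Set (CoordIndex w → ℝ)) :
    volume (pairingMap v w '' s) = ENNReal.ofReal |v ⬝ᵥ w| * volume s := by
  obtain ⟨z, zo, hvz, hz⟩ := hv
  obtain ⟨x, xo, hwx, hx⟩ := hw
  have hcast : v ⬝ᵥ w = ((z ⬝ᵥ x : ℤ) : ℝ) := by rw [hvz, hwx]; simp [dotProduct]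
  let e : CoordIndex v ≃ Fin d := Fintype.equivFinOfCardEq (card_coordIndex hvz hz)
  let f : CoordIndex w ≃ Fin d := Fintype.equivFinOfCardEq (card_coordIndex hwx hx)
  -- The two index types are different, so the columns are relabelled to obtain a square matrix; the
  -- relabelling preserves volume.
  let σ : CoordIndex w ≃ CoordIndex v := f.trans e.symm
  let A : Matrix (CoordIndex v) (CoordIndex v) ℝ :=
    Matrix.of fun i i' => coordVector v i ⬝ᵥ coordVector w (σ.symm i')
  let ρ := MeasurableEquiv.piCongrLeft (fun _ : CoordIndex v => ℝ) σ
  have hρ : ∀ (t : CoordIndex w → ℝ) i, ρ t i = t (σ.symm i) := fun t i => by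
    have := Equiv.piCongrLeft_apply_apply (fun _ : CoordIndex v => ℝ) σ t (σ.symm i)
    simpa [ρ, MeasurableEquiv.coe_piCongrLeft] using this
  have hcomp : ∀ t, pairingMap v w t = Matrix.toLin' A (ρ t) := by
    intro t
    ext i
    simp only [pairingMap, A, Matrix.toLin'_apply, Matrix.mulVec, Matrix.of_apply]
    simp only [dotProduct, hρ]
    exact (σ.symm.sum_comp (fun j => (∑ c, coordVector v i c * coordVector w j c) * t j)).symm
  have himg : pairingMap v w '' s = Matrix.toLin' A '' (ρ '' s) := by
    rw [image_image]; exact image_congr fun t _ => hcomp t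
  have hdet : |A.det| = |v ⬝ᵥ w| := by
    have h := abs_det_pairing hvz hwx hz hx (fun h0 => hne (by rw [hcast, h0]; simp)) e f
    set A' := (Matrix.of fun i j => latticeBasis v (e.symm i) ⬝ᵥ latticeBasis w (f.symm j) :
      Matrix (Fin d) (Fin d) ℤ)
    have : A.submatrix e.symm e.symm = A'.map (Int.cast : ℤ → ℝ) := by
      ext i j
      simp [A, A', σ, coordVector_eq, dotProduct]
    have hd : A.det = ((A'.det : ℤ) : ℝ) := by
      rw [← Matrix.det_submatrix_equiv_self e.symm, this]
      exact (RingHom.map_det (Int.castRingHom ℝ) A').symm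
    rw [hd, hcast, ← Int.cast_abs, h, Int.cast_abs]
  rw [himg, Measure.addHaar_image_linearMap, LinearMap.det_toLin', hdet]
  congr 1
  have := (volume_measurePreserving_piCongrLeft (fun _ : CoordIndex v => ℝ) σ).symm
  rw [MeasurableEquiv.image_eq_preimage_symm]
  exact this.measure_preimage_equiv s

/-- Domain and target have the same dimension, and a proper range would be null, against the volume
formula. -/
theorem pairingMap_injective (hv : IsPrimitiveVector v) (hw : IsPrimitiveVector w)
    (hne : v ⬝ᵥ w ≠ 0) : Function.Injective (pairingMap v w) := by
  rw [← LinearMap.ker_eq_bot]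
  by_contra hker
  obtain ⟨z, zo, hvz, hz⟩ := id hv
  obtain ⟨x, xo, hwx, hx⟩ := id hw
  have hlt : LinearMap.range (pairingMap v w) ≠ ⊤ := fun htop => by
    have h1 := LinearMap.finrank_range_add_finrank_ker (pairingMap v w)
    rw [htop, finrank_top, Module.finrank_fintype_fun_eq_card, Module.finrank_fintype_fun_eq_card,
      card_coordIndex hvz hz, card_coordIndex hwx hx] at h1
    have : Module.finrank ℝ (LinearMap.ker (pairingMap v w)) = 0 := by omega
    exact hker (Submodule.finrank_eq_zero.1 this)
  have h0 : volume (LinearMap.range (pairingMap v w) : Set (CoordIndex v → ℝ)) = 0 :=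
    Measure.addHaar_submodule _ _ hlt
  rw [LinearMap.coe_range, ← image_univ, volume_pairingMap_image hv hw hne, mul_eq_zero] at h0
  rcases h0 with h0 | h0
  · exact hne (by simpa using h0)
  · exact (isOpen_univ.measure_pos volume univ_nonempty).ne' h0

theorem coordVector_dot (hv : IsPrimitiveVector v) (i : CoordIndex v) : coordVector v i ⬝ᵥ v = 0 := by
  obtain ⟨z, zo, hvz, hz⟩ := hv
  have h : ((latticeBasis v i ⬝ᵥ z : ℤ) : ℝ) = 0 := by rw [latticeBasis_dot hvz]; simp
  have hj : ∀ j, v j = z j := congrFun hvz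
  rw [← h]
  simp [dotProduct, coordVector_eq, hj]

theorem eq_smul_of_lineProj_eq_zero (hv : IsPrimitiveVector v) {p : Fin (d + 1) → ℝ}
    (hp : lineProj v p = 0) : ∃ s : ℝ, p = s • v := by
  obtain ⟨z, zo, hvz, hz⟩ := hv
  refine ⟨p ⬝ᵥ (fun j => (zo j : ℝ)), ?_⟩
  ext j
  obtain ⟨a, ha⟩ := exists_latticeBasis_repr (y := Pi.single j 1 - z j • zo) hvz (by
    rw [sub_dotProduct, smul_dotProduct, dotProduct_comm zo, hz]; simp)
  have hreal : (Pi.single j 1 - (z j : ℝ) • (fun c => (zo c : ℝ)) : Fin (d + 1) → ℝ) =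
      ∑ i, (a i : ℝ) • coordVector v i := by
    ext c
    have := congrArg (Int.cast : ℤ → ℝ) (congrFun ha c)
    simpa [coordVector_eq, Pi.single_apply, Finset.sum_apply] using this
  have := congrArg (fun y => p ⬝ᵥ y) hreal
  simp only [dotProduct_sub, dotProduct_smul, dotProduct_sum, dotProduct_single_one] at this
  have h0 : ∀ i, p ⬝ᵥ coordVector v i = 0 := fun i => congrFun hp i
  simp only [h0, smul_zero, Finset.sum_const_zero] at this
  rw [Pi.smul_apply, hvz]
  simp only [smul_eq_mul] at this ⊢
  linarith

theorem exists_coordVector_repr (hv : IsPrimitiveVector v) {x : Fin (d + 1) → ℝ}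
    (hx : x ⬝ᵥ v = 0) : ∃ t : CoordIndex v → ℝ, x = ∑ i, t i • coordVector v i := by
  obtain ⟨z, zo, hvz, hz⟩ := hv
  have hrep : ∀ j : Fin (d + 1), ∃ a : CoordIndex v → ℤ,
      (Pi.single j 1 - z j • zo : Fin (d + 1) → ℤ) = ∑ i, a i • latticeBasis v i := fun j =>
    exists_latticeBasis_repr hvz (by
      rw [sub_dotProduct, smul_dotProduct, dotProduct_comm zo, hz]; simp)
  choose a ha using hrep
  refine ⟨fun i => ∑ j, x j * a j i, ?_⟩
  ext c
  have h : ∀ j, ((Pi.single j 1 : Fin (d + 1) → ℝ) c - z j * zo c) =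
      ∑ i, (a j i : ℝ) * coordVector v i c := fun j => by
    have := congrArg (Int.cast : ℤ → ℝ) (congrFun (ha j) c)
    simpa [coordVector_eq, Pi.single_apply, Finset.sum_apply] using this
  have h2 : ∑ j, x j * ((Pi.single j 1 : Fin (d + 1) → ℝ) c - z j * zo c) = x c := by
    simp only [mul_sub, Finset.sum_sub_distrib, ← mul_assoc, ← Finset.sum_mul]
    have : ∑ j, x j * (z j : ℝ) = 0 := by rw [hvz] at hx; exact hx
    rw [this]; simp [Pi.single_apply]
  rw [← h2]
  simp only [h, Finset.sum_apply, Pi.smul_apply, smul_eq_mul, Finset.mul_sum, Finset.sum_mul]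
  rw [Finset.sum_comm]
  simp only [mul_assoc]

end Lattice

/-! ### Projection along a primitive direction. -/

section LineProj

variable {d : ℕ} {v w : Fin (d + 1) → ℝ}

theorem lineProj_add (v p q : Fin (d + 1) → ℝ) : lineProj v (p + q) = lineProj v p + lineProj v q := by
  ext i; simp [lineProj, add_dotProduct]

theorem lineProj_smul (v p : Fin (d + 1) → ℝ) (s : ℝ) : lineProj v (s • p) = s • lineProj v p := by
  ext i; simp [lineProj, smul_dotProduct]

theorem lineProj_sub (v p q : Fin (d + 1) → ℝ) : lineProj v (p - q) = lineProj v p - lineProj v q := by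
  ext i; simp [lineProj, sub_dotProduct]

theorem lineProj_self (hv : IsPrimitiveVector v) : lineProj v v = 0 := by
  ext i; rw [lineProj, dotProduct_comm, coordVector_dot hv]; rfl

theorem continuous_lineProj (v : Fin (d + 1) → ℝ) : Continuous (lineProj v) :=
  continuous_pi fun _ => WeightedNormals.continuous_dot _

theorem lineProj_eq_iff (hv : IsPrimitiveVector v) {p q : Fin (d + 1) → ℝ} :
    lineProj v p = lineProj v q ↔ ∃ s : ℝ, q = p + s • v := by
  constructor
  · intro h
    obtain ⟨s, hs⟩ := eq_smul_of_lineProj_eq_zero hv (p := q - p) (by rw [lineProj_sub, h, sub_self])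
    exact ⟨s, by rw [← hs]; abel⟩
  · rintro ⟨s, rfl⟩
    rw [lineProj_add, lineProj_smul, lineProj_self hv]; simp

theorem lineProj_sum (w : Fin (d + 1) → ℝ) (t : CoordIndex v → ℝ) :
    lineProj w (∑ i, t i • coordVector v i) = pairingMap w v t := by
  ext j
  simp only [lineProj, pairingMap, Matrix.toLin'_apply, Matrix.mulVec, Matrix.of_apply]
  rw [sum_dotProduct]
  simp only [smul_dotProduct, smul_eq_mul]
  rw [dotProduct]
  exact Finset.sum_congr rfl fun i _ => by rw [dotProduct_comm (coordVector v i), mul_comm]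

theorem IsPrimitiveVector.ne_zero (hv : IsPrimitiveVector v) : v ≠ 0 := by
  obtain ⟨z, zo, hvz, hz⟩ := hv
  rintro rfl
  have : z = 0 := by
    ext i
    have := congrFun hvz i
    simp only [Pi.zero_apply] at this
    exact_mod_cast this.symm
  rw [this] at hz; simp at hz

theorem volume_level_set_eq_zero {ι : Type*} [Fintype ι] (ℓ : (ι → ℝ) →ₗ[ℝ] ℝ) (hℓ : ℓ ≠ 0) (c : ℝ) :
    volume {t | ℓ t = c} = 0 := by
  rcases eq_empty_or_nonempty {t | ℓ t = c} with h | ⟨t₀, ht₀⟩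
  · rw [h]; simp
  · have : {t | ℓ t = c} = (fun t => t + (-t₀)) ⁻¹' (LinearMap.ker ℓ : Set (ι → ℝ)) := by
      ext t
      simp only [mem_ofPred_eq, mem_preimage, SetLike.mem_coe, LinearMap.mem_ker, map_add, map_neg]
      rw [show ℓ t₀ = c from ht₀]
      constructor <;> intro h <;> linarith
    rw [this, measure_preimage_add_right]
    exact Measure.addHaar_submodule _ _ fun h => hℓ (LinearMap.ker_eq_top.1 h)

end LineProj

/-! ### Integral charts, the measures on the faces, and their projections. -/

namespace WeightedNormals

variable {d : ℕ} {P Q : WeightedNormals d}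

theorem chart_sub (P : WeightedNormals d) (v : Fin (d + 1) → ℝ) (t : CoordIndex v → ℝ) :
    P.chart v t = P.chart v 0 + ∑ i, t i • coordVector v i := by
  simp [chart]

theorem continuous_chart (P : WeightedNormals d) (v : Fin (d + 1) → ℝ) : Continuous (P.chart v) := by
  unfold chart; fun_prop

theorem chart_dot (P : WeightedNormals d) {v : Fin (d + 1) → ℝ} (hv : IsPrimitiveVector v)
    (t : CoordIndex v → ℝ) : P.chart v t ⬝ᵥ v = -P.weight v := by
  have : v ⬝ᵥ v ≠ 0 := fun h => hv.ne_zero (dotProduct_self_eq_zero.1 h)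
  rw [chart, add_dotProduct, sum_dotProduct, smul_dotProduct]
  simp only [smul_dotProduct, coordVector_dot hv, smul_eq_mul, mul_zero, Finset.sum_const_zero,
    add_zero]
  field_simp

theorem exists_chart_eq (P : WeightedNormals d) {v x : Fin (d + 1) → ℝ} (hv : IsPrimitiveVector v)
    (hx : x ⬝ᵥ v = -P.weight v) : ∃ t, P.chart v t = x := by
  obtain ⟨t, ht⟩ := exists_coordVector_repr hv (x := x - P.chart v 0) (by
    rw [sub_dotProduct, hx, P.chart_dot hv, sub_self])
  exact ⟨t, by rw [chart_sub, ← ht]; abel⟩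

theorem lineProj_chart (P : WeightedNormals d) (v w : Fin (d + 1) → ℝ) (t : CoordIndex v → ℝ) :
    lineProj w (P.chart v t) = lineProj w (P.chart v 0) + pairingMap w v t := by
  rw [chart_sub, lineProj_add, lineProj_sum]

theorem chart_dot_eq (P : WeightedNormals d) (v p : Fin (d + 1) → ℝ) (t : CoordIndex v → ℝ) :
    P.chart v t ⬝ᵥ p = P.chart v 0 ⬝ᵥ p + t ⬝ᵥ lineProj v p := by
  rw [chart_sub, add_dotProduct, sum_dotProduct]
  congr 1
  exact Finset.sum_congr rfl fun i _ => by
    rw [smul_dotProduct, smul_eq_mul, lineProj, dotProduct_comm p]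

namespace IsDualPair

theorem isPrimitive_left (h : IsDualPair P Q) {m : Fin (d + 1) → ℝ} (hm : m ∈ P.normals) :
    IsPrimitiveVector m := by
  obtain ⟨n, hn, h1⟩ := h.exists_dot_eq_one_left m hm
  obtain ⟨z, rfl⟩ := h.integral_left m hm
  obtain ⟨zo, rfl⟩ := h.integral_right n hn
  refine ⟨z, zo, rfl, ?_⟩
  have : ((z ⬝ᵥ zo : ℤ) : ℝ) = 1 := by rw [← h1]; simp [dotProduct]
  exact_mod_cast this

theorem isPrimitive_right (h : IsDualPair P Q) {n : Fin (d + 1) → ℝ} (hn : n ∈ Q.normals) :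
    IsPrimitiveVector n := h.symm.isPrimitive_left hn

theorem isClosedEmbedding_chart (h : IsDualPair P Q) {m : Fin (d + 1) → ℝ} (hm : m ∈ P.normals) :
    Topology.IsClosedEmbedding (P.chart m) := by
  obtain ⟨n, hn, h1⟩ := h.exists_dot_eq_one_left m hm
  let ℓ : (CoordIndex m → ℝ) →ₗ[ℝ] (Fin (d + 1) → ℝ) := Fintype.linearCombination ℝ (coordVector m)
  have hℓ : ∀ t, ℓ t = ∑ i, t i • coordVector m i := fun t => by
    simp [ℓ, Fintype.linearCombination_apply]
  have hinj : Function.Injective ℓ := by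
    intro t t' htt
    apply pairingMap_injective (h.isPrimitive_right hn) (h.isPrimitive_left hm)
      (by rw [dotProduct_comm, h1]; exact one_ne_zero)
    rw [← lineProj_sum, ← lineProj_sum, ← hℓ, ← hℓ, htt]
  have he := ℓ.isClosedEmbedding_of_injective (LinearMap.ker_eq_bot.2 hinj)
  have hc : P.chart m = (Homeomorph.addLeft (P.chart m 0)) ∘ ℓ := by
    ext1 t; simp [chart_sub P m t, hℓ]
  rw [hc]
  exact (Homeomorph.isClosedEmbedding _).comp he

theorem faceMeasure_apply (h : IsDualPair P Q) {m : Fin (d + 1) → ℝ} (hm : m ∈ P.normals)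
    (G : Set (Fin (d + 1) → ℝ)) :
    P.faceMeasure m G = volume (P.chart m ⁻¹' (G ∩ P.face m)) := by
  rw [faceMeasure, Measure.restrict_apply' (P.isClosed_face m).measurableSet,
    (h.isClosedEmbedding_chart hm).measurableEmbedding.map_apply]

theorem faceMeasure_inter (h : IsDualPair P Q) {m : Fin (d + 1) → ℝ} (hm : m ∈ P.normals)
    (G : Set (Fin (d + 1) → ℝ)) : P.faceMeasure m (G ∩ P.face m) = P.faceMeasure m G := by
  rw [h.faceMeasure_apply hm, h.faceMeasure_apply hm, inter_assoc, inter_self]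

/-- In the chart of the face, the projection is a translate of `pairingMap n m`, with Jacobian `|⟨n,
m⟩|`. Valid for arbitrary subsets of the face, with outer measures. -/
theorem volume_lineProj_image (h : IsDualPair P Q) {m n : Fin (d + 1) → ℝ} (hm : m ∈ P.normals)
    (hn : n ∈ Q.normals) (hne : n ⬝ᵥ m ≠ 0) {G : Set (Fin (d + 1) → ℝ)} (hG : G ⊆ P.face m) :
    volume (lineProj n '' G) = ENNReal.ofReal |n ⬝ᵥ m| * P.faceMeasure m G := by
  have him : lineProj n '' G = (fun y => lineProj n (P.chart m 0) + y) ''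
      (pairingMap n m '' (P.chart m ⁻¹' G)) := by
    ext y
    simp only [mem_image, mem_preimage, exists_exists_and_eq_and]
    constructor
    · rintro ⟨x, hx, rfl⟩
      obtain ⟨t, rfl⟩ := P.exists_chart_eq (h.isPrimitive_left hm) (hG hx).2
      exact ⟨t, hx, (P.lineProj_chart m n t).symm⟩
    · rintro ⟨t, ht, rfl⟩
      exact ⟨_, ht, P.lineProj_chart m n t⟩
  rw [him, image_add_left, measure_preimage_add,
    volume_pairingMap_image (h.isPrimitive_right hn) (h.isPrimitive_left hm) hne,
    h.faceMeasure_apply hm, inter_eq_left.2 hG]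

theorem faceMeasure_face_eq_zero (h : IsDualPair P Q) {m m' : Fin (d + 1) → ℝ} (hm : m ∈ P.normals)
    (hm' : m' ∈ P.normals) (hne : m ≠ m') : P.faceMeasure m (P.face m') = 0 := by
  rw [h.faceMeasure_apply hm]
  -- If `m'` is parallel to `m`, the signs of the weights exclude a common point unless `m' = m`;
  -- otherwise the intersection lies in a hyperplane of the chart.
  by_cases hl : lineProj m m' = 0
  · obtain ⟨s, hs⟩ := eq_smul_of_lineProj_eq_zero (h.isPrimitive_left hm) hl
    have : P.face m' ∩ P.face m = ∅ := by
      by_contra hemp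
      obtain ⟨x, hx', hx⟩ := nonempty_iff_ne_empty.2 hemp
      have e' := hx'.2
      rw [hs, dotProduct_smul, hx.2, ← hs, smul_eq_mul] at e'
      have a := h.weight_lt hm
      have b := h.weight_lt hm'
      exact hne (h.eq_of_eq_smul hm hm' (c := s) (by nlinarith) hs).symm
    rw [this]; simp
  · let ℓ : (CoordIndex m → ℝ) →ₗ[ℝ] ℝ := Fintype.linearCombination ℝ (lineProj m m')
    have hℓ : ∀ t, ℓ t = t ⬝ᵥ lineProj m m' := fun t => by
      simp [ℓ, Fintype.linearCombination_apply, dotProduct]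
    refine measure_mono_null (t := {t | ℓ t = -P.weight m' - P.chart m 0 ⬝ᵥ m'}) ?_
      (volume_level_set_eq_zero ℓ ?_ _)
    · rintro t ⟨ht, -⟩
      have := ht.2
      rw [chart_dot_eq] at this
      rw [mem_ofPred_eq, hℓ]; linarith
    · intro h0
      apply hl
      ext i
      have := LinearMap.congr_fun h0 (Pi.single i 1)
      rw [hℓ] at this
      simpa using this

theorem boundaryMeasure_apply (h : IsDualPair P Q) (G : Set (Fin (d + 1) → ℝ)) :
    P.boundaryMeasure G = ∑' m : P.normals, P.faceMeasure m G := by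
  have := h.finite_left.countable.to_subtype
  exact Measure.sum_apply_of_countable _ _

theorem boundaryMeasure_eq_faceMeasure (h : IsDualPair P Q) {m : Fin (d + 1) → ℝ}
    (hm : m ∈ P.normals) {G : Set (Fin (d + 1) → ℝ)} (hG : G ⊆ P.face m) :
    P.boundaryMeasure G = P.faceMeasure m G := by
  rw [h.boundaryMeasure_apply, tsum_eq_single (⟨m, hm⟩ : P.normals)]
  rintro ⟨m', hm'⟩ hne
  exact measure_mono_null hG (h.faceMeasure_face_eq_zero hm' hm fun e => hne (Subtype.ext e))

theorem boundaryMeasure_compl (h : IsDualPair P Q) : P.boundaryMeasure P.boundaryᶜ = 0 := by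
  rw [h.boundaryMeasure_apply, ENNReal.tsum_eq_zero]
  rintro ⟨m, hm⟩
  rw [h.faceMeasure_apply hm]
  convert measure_empty (μ := volume)
  rw [eq_empty_iff_forall_notMem]
  exact fun t ht => ht.1 ht.2.1

theorem boundaryMeasure_face_inter_face (h : IsDualPair P Q) {m m' : Fin (d + 1) → ℝ}
    (hm : m ∈ P.normals) (hm' : m' ∈ P.normals) (hne : m ≠ m') :
    P.boundaryMeasure (P.face m ∩ P.face m') = 0 := by
  rw [h.boundaryMeasure_eq_faceMeasure hm inter_subset_left]
  exact measure_mono_null inter_subset_right (h.faceMeasure_face_eq_zero hm hm' hne)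

theorem boundaryMeasure_univ_lt_top (h : IsDualPair P Q) : P.boundaryMeasure univ < ⊤ := by
  have := h.finite_left.fintype
  rw [h.boundaryMeasure_apply, tsum_fintype]
  refine ENNReal.sum_lt_top.2 ?_
  rintro ⟨m, hm⟩ -
  rw [h.faceMeasure_apply hm, univ_inter]
  exact ((h.isClosedEmbedding_chart hm).isCompact_preimage (h.isCompact_face m)).measure_lt_top

/-- The projection along a normal `m` maps the union of the opposite faces to Euclidean space in a
measure preserving way. -/
theorem volume_lineProj_image_posFaces (h : IsDualPair P Q) {m : Fin (d + 1) → ℝ}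
    (hm : m ∈ P.normals) {G : Set (Fin (d + 1) → ℝ)} (hG : G ⊆ Q.posFaces m) :
    volume (lineProj m '' G) = Q.boundaryMeasure G := by
  classical
  have hcount := h.finite_right.countable.to_subtype
  -- The shadows of the faces making up `H_m^+`. They are compact and overlap only in null sets, so
  -- they split the volume of the possibly non-measurable image of `G`.
  let C : Q.normals → Set (CoordIndex m → ℝ) := fun n =>
    if (n : Fin (d + 1) → ℝ) ⬝ᵥ m = 1 then lineProj m '' Q.face n else ∅
  have hinj : ∀ p ∈ Q.posFaces m, ∀ q ∈ Q.posFaces m, lineProj m p = lineProj m q → q = p := by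
    intro p hp q hq he
    obtain ⟨s, hs⟩ := (lineProj_eq_iff (h.isPrimitive_left hm)).1 he
    exact posFaces_unique m hp hq hs
  have hCm : ∀ n, MeasurableSet (C n) := fun n => by
    by_cases h1 : (n : Fin (d + 1) → ℝ) ⬝ᵥ m = 1
    · simp only [C, h1, if_true]
      exact ((h.symm.isCompact_face n).image (continuous_lineProj m)).measurableSet
    · simp [C, h1]
  have hsub : ∀ n : Q.normals, (n : Fin (d + 1) → ℝ) ⬝ᵥ m = 1 → Q.face n ⊆ Q.posFaces m :=
    fun n h1 p hp => ⟨n, n.2, h1, hp⟩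
  have hvol : ∀ n : Q.normals, (n : Fin (d + 1) → ℝ) ⬝ᵥ m = 1 → ∀ G' ⊆ Q.face n,
      volume (lineProj m '' G') = Q.faceMeasure n G' := fun n h1 G' hG' => by
    have h1' : m ⬝ᵥ (n : Fin (d + 1) → ℝ) = 1 := by rw [dotProduct_comm]; exact h1
    rw [h.symm.volume_lineProj_image n.2 hm (by rw [h1']; exact one_ne_zero) hG', h1']
    simp
  have hterm : ∀ n : Q.normals, (volume.restrict (lineProj m '' G)) (C n) = Q.faceMeasure n G := by
    intro n
    rw [Measure.restrict_apply (hCm n)]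
    by_cases h1 : (n : Fin (d + 1) → ℝ) ⬝ᵥ m = 1
    · rw [← h.symm.faceMeasure_inter n.2, ← hvol n h1 _ inter_subset_right]
      congr 1
      simp only [C, h1, if_true]
      ext y
      constructor
      · rintro ⟨⟨p, hp, rfl⟩, q, hq, hpq⟩
        have := hinj p (hsub n h1 hp) q (hG hq) hpq.symm
        subst this
        exact ⟨_, ⟨hq, hp⟩, rfl⟩
      · rintro ⟨p, hp, rfl⟩
        exact ⟨⟨p, hp.2, rfl⟩, p, hp.1, rfl⟩
    · simp only [C, h1, if_false, empty_inter, measure_empty]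
      symm
      refine measure_mono_null (t := ⋃ n' ∈ {n' ∈ Q.normals | n' ⬝ᵥ m = 1}, Q.face n') ?_ ?_
      · intro p hp
        obtain ⟨n', hn', h1', hp'⟩ := hG hp
        exact mem_biUnion (show n' ∈ {n' ∈ Q.normals | n' ⬝ᵥ m = 1} from ⟨hn', h1'⟩) hp'
      · rw [measure_biUnion_null_iff (h.finite_right.subset (sep_subset _ _)).countable]
        rintro n' ⟨hn', h1'⟩
        exact h.symm.faceMeasure_face_eq_zero n.2 hn' fun e => h1 (e ▸ h1')
  have hunion : (volume.restrict (lineProj m '' G)) (⋃ n, C n) = volume (lineProj m '' G) := by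
    rw [Measure.restrict_apply (MeasurableSet.iUnion hCm), inter_eq_right.2]
    rintro _ ⟨p, hp, rfl⟩
    obtain ⟨n, hn, h1, hpn⟩ := hG hp
    refine mem_iUnion.2 ⟨⟨n, hn⟩, ?_⟩
    simp only [C, h1, if_true]
    exact ⟨p, hpn, rfl⟩
  rw [← hunion, h.symm.boundaryMeasure_apply, measure_iUnion₀ ?_ fun n => (hCm n).nullMeasurableSet]
  · exact tsum_congr hterm
  · intro n n' hne
    refine measure_mono_null ?_ (Measure.restrict_le_self.absolutelyContinuous
      (?_ : volume (C n ∩ C n') = 0)) 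
    · exact subset_rfl
    · by_cases h1 : (n : Fin (d + 1) → ℝ) ⬝ᵥ m = 1
      · by_cases h1' : (n' : Fin (d + 1) → ℝ) ⬝ᵥ m = 1
        · simp only [C, h1, h1', if_true]
          refine measure_mono_null (t := lineProj m '' (Q.face n' ∩ Q.face n)) ?_ ?_
          · rintro _ ⟨⟨p, hp, rfl⟩, q, hq, hpq⟩
            have := hinj p (hsub n h1 hp) q (hsub n' h1' hq) hpq.symm
            subst this
            exact ⟨_, ⟨hq, hp⟩, rfl⟩
          · rw [hvol n h1 _ inter_subset_right, h.symm.faceMeasure_inter n.2]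
            exact h.symm.faceMeasure_face_eq_zero n.2 n'.2 fun e => hne (Subtype.ext e)
        · simp [C, h1']
      · simp [C, h1]

theorem zero_mem_interior_body (h : IsDualPair P Q) : (0 : Fin (d + 1) → ℝ) ∈ interior P.body := by
  by_contra hint
  obtain ⟨-, m, hm, h0⟩ := h.mem_boundary_iff.1
    (show (0 : Fin (d + 1) → ℝ) ∈ P.boundary from ⟨subset_closure h.zero_mem_body, hint⟩)
  have := h.weight_lt hm
  simp at h0
  linarith

open scoped Pointwise in
-- A null boundary would give `P.posFaces n` a null shadow along `n`. Every point of the body moves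
-- along `n` to an exit point, so the body would have a null shadow too; as dilates of the body fill
-- the space, so would the whole space.
theorem boundaryMeasure_univ_ne_zero (h : IsDualPair P Q) : P.boundaryMeasure univ ≠ 0 := by
  intro h0
  obtain ⟨n, hn⟩ := h.nonempty_right
  obtain ⟨m, hm, h1⟩ := h.exists_dot_eq_one_right n hn
  have hpos : volume (lineProj n '' P.posFaces n) = 0 := by
    rw [h.symm.volume_lineProj_image_posFaces hn subset_rfl]
    exact measure_mono_null (subset_univ _) h0
  have hbody : volume (lineProj n '' P.body) = 0 := by
    refine measure_mono_null ?_ hpos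
    rintro _ ⟨x, hx, rfl⟩
    obtain ⟨s, -, hs⟩ := h.symm.exists_exit hn hx
    exact ⟨_, hs, ((lineProj_eq_iff (h.isPrimitive_right hn)).2 ⟨s, rfl⟩).symm⟩
  have hall : volume (range (lineProj n)) = 0 := by
    refine measure_mono_null (t := ⋃ k : ℕ, ((k : ℝ) + 1) • (lineProj n '' P.body)) ?_ ?_
    · rintro _ ⟨x, rfl⟩
      have hlim : Filter.Tendsto (fun k : ℕ => (1 / ((k : ℝ) + 1)) • x) Filter.atTop (nhds 0) := by
        have := (tendsto_one_div_add_atTop_nhds_zero_nat (𝕜 := ℝ)).smul_const x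
        rwa [zero_smul] at this
      obtain ⟨k, hk⟩ := (hlim.eventually
        (mem_interior_iff_mem_nhds.1 h.zero_mem_interior_body)).exists
      refine mem_iUnion.2 ⟨k, (mem_smul_set_iff_inv_smul_mem₀ (by positivity) _ _).2 ⟨_, hk, ?_⟩⟩
      rw [lineProj_smul, one_div]
    · exact measure_iUnion_null fun k => by rw [Measure.addHaar_smul, hbody, mul_zero]
  have hfull : volume (pairingMap n m '' univ) = 0 := by
    refine measure_mono_null ?_ hall
    rintro _ ⟨t, -, rfl⟩
    exact ⟨_, lineProj_sum n t⟩
  have h1' : n ⬝ᵥ m = 1 := by rw [dotProduct_comm]; exact h1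
  rw [volume_pairingMap_image (h.isPrimitive_right hn) (h.isPrimitive_left hm)
    (by rw [h1']; exact one_ne_zero), h1'] at hfull
  simp only [abs_one, ENNReal.ofReal_one, one_mul] at hfull
  exact (isOpen_univ.measure_pos volume univ_nonempty).ne' hfull

theorem isProbabilityMeasure (h : IsDualPair P Q) : IsProbabilityMeasure P.probMeasure :=
  ⟨by
    rw [probMeasure, Measure.smul_apply, smul_eq_mul]
    exact ENNReal.inv_mul_cancel h.boundaryMeasure_univ_ne_zero h.boundaryMeasure_univ_lt_top.ne⟩

theorem probMeasure_apply (P : WeightedNormals d) (G : Set (Fin (d + 1) → ℝ)) :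
    P.probMeasure G = (P.boundaryMeasure univ)⁻¹ * P.boundaryMeasure G := rfl

theorem probMeasure_eq_zero_iff (h : IsDualPair P Q) {G : Set (Fin (d + 1) → ℝ)} :
    P.probMeasure G = 0 ↔ P.boundaryMeasure G = 0 := by
  rw [probMeasure_apply, mul_eq_zero, ENNReal.inv_eq_zero]
  exact or_iff_right h.boundaryMeasure_univ_lt_top.ne

theorem probMeasure_le_of_boundaryMeasure_le {G G' : Set (Fin (d + 1) → ℝ)}
    (h : P.boundaryMeasure G ≤ P.boundaryMeasure G') : P.probMeasure G ≤ P.probMeasure G' := by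
  rw [probMeasure_apply, probMeasure_apply]; gcongr

theorem ae_mem_boundary (h : IsDualPair P Q) : ∀ᵐ x ∂P.probMeasure, x ∈ P.boundary := by
  rw [ae_iff, h.probMeasure_eq_zero_iff]
  exact h.boundaryMeasure_compl

end IsDualPair

end WeightedNormals

/-! ### Legendre transforms, conjugate pairs and regular points. -/

namespace WeightedNormals

variable {d : ℕ} {P Q : WeightedNormals d}

namespace IsDualPair

theorem exists_abs_dot_le (h : IsDualPair P Q) :
    ∃ R : NNReal, ∀ p ∈ Q.boundary, ∀ x : Fin (d + 1) → ℝ, |p ⬝ᵥ x| ≤ R * ‖x‖ := by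
  obtain ⟨r, hr⟩ := h.bounded_right.exists_norm_le
  refine ⟨⟨(d + 1) * |r|, by positivity⟩, fun p hp x => ?_⟩
  have hpr : ‖p‖ ≤ |r| := (hr p (Q.boundary_subset_body hp)).trans (le_abs_self r)
  calc |p ⬝ᵥ x| ≤ ∑ i, |p i * x i| := Finset.abs_sum_le_sum_abs _ _
    _ ≤ ∑ _i : Fin (d + 1), |r| * ‖x‖ := by
        refine Finset.sum_le_sum fun i _ => ?_
        rw [abs_mul]
        exact mul_le_mul ((norm_le_pi_norm p i).trans hpr) (norm_le_pi_norm x i) (abs_nonneg _)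
          (abs_nonneg _)
    _ = ((d + 1) * |r|) * ‖x‖ := by simp; ring

variable {ψ : (Fin (d + 1) → ℝ) → ℝ} {C : ℝ}

theorem bddAbove_legendre (h : IsDualPair P Q) (hψ : ∀ p ∈ Q.boundary, |ψ p| ≤ C)
    (x : Fin (d + 1) → ℝ) :
    BddAbove (range fun p : Q.boundary => (p : Fin (d + 1) → ℝ) ⬝ᵥ x - ψ p) := by
  obtain ⟨R, hR⟩ := h.exists_abs_dot_le
  refine ⟨R * ‖x‖ + C, ?_⟩
  rintro _ ⟨⟨p, hp⟩, rfl⟩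
  have h1 := (abs_le.1 (hR p hp x)).2
  have h2 := (abs_le.1 (hψ p hp)).1
  simp only
  linarith

theorem le_legendre (h : IsDualPair P Q) (hψ : ∀ p ∈ Q.boundary, |ψ p| ≤ C)
    {p : Fin (d + 1) → ℝ} (hp : p ∈ Q.boundary) (x : Fin (d + 1) → ℝ) :
    p ⬝ᵥ x - ψ p ≤ Q.legendre ψ x :=
  le_ciSup (h.bddAbove_legendre hψ x) ⟨p, hp⟩

theorem legendre_le (h : IsDualPair P Q) {x : Fin (d + 1) → ℝ} {c : ℝ}
    (hc : ∀ p ∈ Q.boundary, p ⬝ᵥ x - ψ p ≤ c) : Q.legendre ψ x ≤ c := by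
  have := h.symm.boundary_nonempty.to_subtype
  exact ciSup_le fun p => hc p p.2

theorem lipschitz_legendre (h : IsDualPair P Q) (hψ : ∀ p ∈ Q.boundary, |ψ p| ≤ C) :
    ∃ K, LipschitzWith K (Q.legendre ψ) := by
  obtain ⟨R, hR⟩ := h.exists_abs_dot_le
  refine ⟨R, LipschitzWith.of_le_add_mul R fun x y => h.legendre_le fun p hp => ?_⟩
  have h1 := h.le_legendre hψ hp y
  have h2 := (abs_le.1 (hR p hp (x - y))).2
  rw [dotProduct_sub, ← dist_eq_norm] at h2
  linarith

theorem convexOn_legendre (h : IsDualPair P Q) (hψ : ∀ p ∈ Q.boundary, |ψ p| ≤ C) :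
    ConvexOn ℝ univ (Q.legendre ψ) := by
  refine ⟨convex_univ, fun x _ y _ a b ha hb hab => h.legendre_le fun p hp => ?_⟩
  have h1 := mul_le_mul_of_nonneg_left (h.le_legendre hψ hp x) ha
  have h2 := mul_le_mul_of_nonneg_left (h.le_legendre hψ hp y) hb
  rw [dotProduct_add, dotProduct_smul, dotProduct_smul]
  simp only [smul_eq_mul]
  have : ψ p = a * ψ p + b * ψ p := by rw [← add_mul, hab, one_mul]
  linarith

theorem abs_legendre_le (h : IsDualPair P Q) (hψ : ∀ p ∈ Q.boundary, |ψ p| ≤ C) :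
    ∃ C', ∀ x ∈ P.boundary, |Q.legendre ψ x| ≤ C' := by
  obtain ⟨K, hK⟩ := h.lipschitz_legendre hψ
  obtain ⟨C', hC'⟩ := h.isCompact_boundary.exists_bound_of_continuousOn hK.continuous.continuousOn
  exact ⟨C', hC'⟩

end IsDualPair

/-- A pair of functions which are Legendre transforms of each other. -/
structure IsConjugatePair (P Q : WeightedNormals d) (f g : (Fin (d + 1) → ℝ) → ℝ) : Prop where
  eq_left : f = Q.legendre g
  eq_right : g = P.legendre f
  bounded_left : ∃ C, ∀ x ∈ P.boundary, |f x| ≤ C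
  bounded_right : ∃ C, ∀ p ∈ Q.boundary, |g p| ≤ C

/-- A point of exactly one face, all of whose conjugate points agree modulo the normal. -/
def IsRegularPoint (P Q : WeightedNormals d) (f : (Fin (d + 1) → ℝ) → ℝ)
    (x : Fin (d + 1) → ℝ) : Prop :=
  ∃ m ∈ P.normals, x ∈ P.face m ∧ (∀ m' ∈ P.normals, x ∈ P.face m' → m' = m) ∧
    ∀ p ∈ conjugateSet P Q f x, ∀ p' ∈ conjugateSet P Q f x, lineProj m p = lineProj m p'

namespace IsConjugatePair

variable {f g : (Fin (d + 1) → ℝ) → ℝ}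

theorem symm (hc : IsConjugatePair P Q f g) : IsConjugatePair Q P g f :=
  ⟨hc.eq_right, hc.eq_left, hc.bounded_right, hc.bounded_left⟩

theorem exists_lipschitz (hc : IsConjugatePair P Q f g) (h : IsDualPair P Q) :
    ∃ K, LipschitzWith K f := by
  obtain ⟨C, hC⟩ := hc.bounded_right
  rw [hc.eq_left]
  exact h.lipschitz_legendre hC

theorem continuous (hc : IsConjugatePair P Q f g) (h : IsDualPair P Q) : Continuous f := by
  obtain ⟨K, hK⟩ := hc.exists_lipschitz h
  exact hK.continuous

theorem convexOn (hc : IsConjugatePair P Q f g) (h : IsDualPair P Q) : ConvexOn ℝ univ f := by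
  obtain ⟨C, hC⟩ := hc.bounded_right
  rw [hc.eq_left]
  exact h.convexOn_legendre hC

theorem young (hc : IsConjugatePair P Q f g) (h : IsDualPair P Q) {p : Fin (d + 1) → ℝ}
    (hp : p ∈ Q.boundary) (x : Fin (d + 1) → ℝ) : x ⬝ᵥ p ≤ g p + f x := by
  obtain ⟨C, hC⟩ := hc.bounded_right
  have := h.le_legendre hC hp x
  rw [← hc.eq_left, dotProduct_comm] at this
  linarith

theorem young' (hc : IsConjugatePair P Q f g) (h : IsDualPair P Q) {x : Fin (d + 1) → ℝ}
    (hx : x ∈ P.boundary) (p : Fin (d + 1) → ℝ) : x ⬝ᵥ p ≤ g p + f x := by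
  have := hc.symm.young h.symm hx p
  rw [dotProduct_comm] at this
  linarith

theorem mem_conjugateSet (hc : IsConjugatePair P Q f g) {x p : Fin (d + 1) → ℝ} :
    p ∈ conjugateSet P Q f x ↔ p ∈ Q.boundary ∧ g p + f x = x ⬝ᵥ p := by
  rw [conjugateSet, ← hc.eq_right]; rfl

theorem mem_conjugateSet_symm (hc : IsConjugatePair P Q f g) {x p : Fin (d + 1) → ℝ}
    (hx : x ∈ P.boundary) (hp : p ∈ conjugateSet P Q f x) : x ∈ conjugateSet Q P g p := by
  rw [hc.mem_conjugateSet] at hp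
  rw [hc.symm.mem_conjugateSet]
  exact ⟨hx, by rw [dotProduct_comm, ← hp.2, add_comm]⟩

theorem exists_mem_conjugateSet (hc : IsConjugatePair P Q f g) (h : IsDualPair P Q)
    (x : Fin (d + 1) → ℝ) : ∃ p, p ∈ conjugateSet P Q f x := by
  have hg := hc.symm.continuous h.symm
  obtain ⟨p, hp, hmax⟩ := h.symm.isCompact_boundary.exists_isMaxOn h.symm.boundary_nonempty
    (f := fun p => p ⬝ᵥ x - g p) ((continuous_dot x).sub hg).continuousOn
  refine ⟨p, hc.mem_conjugateSet.2 ⟨hp, le_antisymm ?_ (hc.young h hp x)⟩⟩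
  have : f x ≤ p ⬝ᵥ x - g p := by
    conv_lhs => rw [hc.eq_left]
    exact h.legendre_le fun q hq => hmax hq
  rw [dotProduct_comm x]; linarith

/-- Conjugacy to a point `x` of a face persists in the direction of the normal of that face. -/
theorem conj_add_smul (hc : IsConjugatePair P Q f g) (h : IsDualPair P Q)
    {m x q : Fin (d + 1) → ℝ} (hm : m ∈ P.normals) (hx : x ∈ P.face m)
    (hq : g q + f x ≤ x ⬝ᵥ q) {s : ℝ} (hs : 0 ≤ s) :
    g (q + s • m) + f x = x ⬝ᵥ (q + s • m) := by
  refine le_antisymm ?_ (hc.young' h hx.1 _)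
  have hg : g (q + s • m) ≤ g q - s * P.weight m := by
    conv_lhs => rw [hc.eq_right]
    refine h.symm.legendre_le fun y hy => ?_
    -- Since `⟨y, m⟩ ≤ -w m` on the body of `P`, the function `g` grows along `m` at most at the
    -- rate `-w m`, which is the growth of `⟨x, ·⟩` for `x` on the face `m`.
    have h1 := hc.young' h hy q
    have h2 := P.boundary_subset_body hy m hm
    rw [dotProduct_add, dotProduct_smul, smul_eq_mul]
    nlinarith
  rw [dotProduct_add, dotProduct_smul, smul_eq_mul, hx.2]
  linarith

theorem exists_exit_conj (hc : IsConjugatePair P Q f g) (h : IsDualPair P Q)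
    {m x q : Fin (d + 1) → ℝ} (hm : m ∈ P.normals) (hx : x ∈ P.face m)
    (hq : g q + f x ≤ x ⬝ᵥ q) (hqb : q ∈ Q.body) :
    ∃ p ∈ conjugateSet P Q f x, p ∈ Q.posFaces m ∧ lineProj m p = lineProj m q := by
  obtain ⟨s, hs, hp⟩ := h.exists_exit hm hqb
  refine ⟨_, hc.mem_conjugateSet.2 ⟨IsDualPair.posFaces_subset_boundary Q m hp,
    hc.conj_add_smul h hm hx hq hs⟩, hp, ?_⟩
  exact ((lineProj_eq_iff (h.isPrimitive_left hm)).2 ⟨s, rfl⟩).symm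

/-- The conjugate points form part of one line in direction `m`, and its exit point is conjugate as
well; no other point of the line is in `H_m^+`. -/
theorem exists_gradientSet_eq (hc : IsConjugatePair P Q f g) (h : IsDualPair P Q)
    {x : Fin (d + 1) → ℝ} (hx : IsRegularPoint P Q f x) : ∃ p, gradientSet P Q f x = {p} := by
  obtain ⟨m, hm, hxm, huniq, hline⟩ := hx
  obtain ⟨q, hq⟩ := hc.exists_mem_conjugateSet h x
  obtain ⟨hqb, hq'⟩ := hc.mem_conjugateSet.1 hq
  obtain ⟨p, hp, hpm, -⟩ := hc.exists_exit_conj h hm hxm hq'.le (Q.boundary_subset_body hqb)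
  refine ⟨p, eq_singleton_iff_unique_mem.2 ⟨⟨hp, fun m' hm' hxm' => ?_⟩, fun p' hp' => ?_⟩⟩
  · rw [huniq m' hm' hxm']; exact hpm
  · obtain ⟨s, hs⟩ := (lineProj_eq_iff (h.isPrimitive_left hm)).1 (hline p hp p' hp'.1)
    exact IsDualPair.posFaces_unique m hpm (hp'.2 m hm hxm) hs

theorem lineProj_eq_of_differentiableAt (hc : IsConjugatePair P Q f g) (h : IsDualPair P Q)
    {m : Fin (d + 1) → ℝ} {t : CoordIndex m → ℝ}
    (ht : DifferentiableAt ℝ (fun t => f (P.chart m t)) t) {p p' : Fin (d + 1) → ℝ}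
    (hp : p ∈ conjugateSet P Q f (P.chart m t)) (hp' : p' ∈ conjugateSet P Q f (P.chart m t)) :
    lineProj m p = lineProj m p' := by
  have key : ∀ q ∈ conjugateSet P Q f (P.chart m t), ∀ i,
      fderiv ℝ (fun t => f (P.chart m t)) t (Pi.single i 1) = lineProj m q i := by
    intro q hq i
    obtain ⟨hqb, hqe⟩ := hc.mem_conjugateSet.1 hq
    let ℓ : (CoordIndex m → ℝ) →L[ℝ] ℝ :=
      LinearMap.toContinuousLinearMap (Fintype.linearCombination ℝ (lineProj m q))
    have hℓ : ∀ s, ℓ s = s ⬝ᵥ lineProj m q := fun s => by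
      simp [ℓ, Fintype.linearCombination_apply, dotProduct]
    -- Young's inequality for `q` is an equality at `t`, so a conjugate point determines the
    -- derivative of `f` in the chart.
    have hmin : IsLocalMin (fun s => f (P.chart m s) - ℓ s) t := by
      refine Filter.Eventually.of_forall fun s => ?_
      have h1 := hc.young h hqb (P.chart m s)
      rw [chart_dot_eq] at h1 hqe
      simp only [hℓ]
      linarith
    have hz := hmin.hasFDerivAt_eq_zero (ht.hasFDerivAt.sub ℓ.hasFDerivAt)
    have := DFunLike.congr_fun hz (Pi.single i 1)
    simp only [sub_apply, zero_apply, hℓ] at this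
    rw [sub_eq_zero.1 this]; simp
  ext i
  rw [← key p hp, ← key p' hp']

theorem ae_isRegularPoint (hc : IsConjugatePair P Q f g) (h : IsDualPair P Q) :
    ∀ᵐ x ∂P.probMeasure, IsRegularPoint P Q f x := by
  rw [ae_iff, h.probMeasure_eq_zero_iff]
  -- Points where `f` cannot be differentiable in the chart; Rademacher's theorem makes this set
  -- null.
  let Z : (Fin (d + 1) → ℝ) → Set (Fin (d + 1) → ℝ) := fun m => {x ∈ P.face m |
    ∃ p ∈ conjugateSet P Q f x, ∃ p' ∈ conjugateSet P Q f x, lineProj m p ≠ lineProj m p'}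
  have hZ : ∀ m ∈ P.normals, P.boundaryMeasure (Z m) = 0 := by
    intro m hm
    have hZm : Z m ⊆ P.face m := sep_subset _ _
    rw [h.boundaryMeasure_eq_faceMeasure hm hZm, h.faceMeasure_apply hm, inter_eq_left.2 hZm]
    obtain ⟨K, hK⟩ := hc.exists_lipschitz h
    let ℓ : (CoordIndex m → ℝ) →L[ℝ] (Fin (d + 1) → ℝ) :=
      LinearMap.toContinuousLinearMap (Fintype.linearCombination ℝ (coordVector m))
    have hch : P.chart m = fun t => P.chart m 0 + ℓ t := by
      ext1 t; rw [chart_sub]; simp [ℓ, Fintype.linearCombination_apply]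
    have hlip : LipschitzWith (K * ‖ℓ‖₊) fun t => f (P.chart m t) := by
      refine hK.comp ?_
      rw [hch]
      refine LipschitzWith.of_dist_le_mul fun s t => ?_
      rw [dist_add_left]
      exact ℓ.lipschitz.dist_le_mul s t
    have hae := hlip.ae_differentiableAt (μ := volume)
    refine measure_mono_null ?_ (ae_iff.1 hae)
    rintro t ⟨-, p, hp, p', hp', hne⟩ hd
    exact hne (hc.lineProj_eq_of_differentiableAt h hd hp hp')
  have hI : P.boundaryMeasure (⋃ m ∈ P.normals, ⋃ m' ∈ P.normals \ {m}, P.face m ∩ P.face m') = 0 := by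
    rw [measure_biUnion_null_iff h.finite_left.countable]
    intro m hm
    rw [measure_biUnion_null_iff (h.finite_left.subset sdiff_subset).countable]
    exact fun m' hm' => h.boundaryMeasure_face_inter_face hm hm'.1 (Ne.symm hm'.2)
  have hU : P.boundaryMeasure (⋃ m ∈ P.normals, Z m) = 0 :=
    (measure_biUnion_null_iff h.finite_left.countable).2 hZ
  refine measure_mono_null ?_
    (measure_union_null (measure_union_null h.boundaryMeasure_compl hI) hU)
  intro x hx
  by_contra hcon
  simp only [mem_union, not_or, mem_compl_iff, not_not, mem_iUnion, not_exists] at hcon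
  obtain ⟨⟨hxb, hxI⟩, hxZ⟩ := hcon
  obtain ⟨m, hm, hxm⟩ := h.exists_face hxb
  refine hx ⟨m, hm, hxm, fun m' hm' hxm' => ?_, fun p hp p' hp' => ?_⟩
  · by_contra hne
    exact hxI m hm m' ⟨hm', hne⟩ ⟨hxm, hxm'⟩
  · by_contra hne
    exact hxZ m hm ⟨hxm, p, hp, p', hp', hne⟩

theorem isClosed_conj_preimage (hc : IsConjugatePair P Q f g) (h : IsDualPair P Q)
    {A K : Set (Fin (d + 1) → ℝ)} (hA : IsCompact A) (hK : IsCompact K) :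
    IsClosed {x ∈ A | ∃ p ∈ K, g p + f x = x ⬝ᵥ p} := by
  have hf := hc.continuous h
  have hg := hc.symm.continuous h.symm
  have hS : IsCompact ((A ×ˢ K) ∩ {z | g z.2 + f z.1 = z.1 ⬝ᵥ z.2}) := by
    refine (hA.prod hK).inter_right (isClosed_eq (by fun_prop) ?_)
    unfold dotProduct; fun_prop
  convert (hS.image continuous_fst).isClosed using 1
  ext x
  simp only [mem_image, mem_inter_iff, mem_prod, mem_ofPred_eq, Prod.exists,
    exists_and_right, exists_eq_right]
  constructor
  · rintro ⟨hx, p, hp, he⟩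
    exact ⟨p, ⟨hx, hp⟩, he⟩
  · rintro ⟨p, ⟨hx, hp⟩, he⟩
    exact ⟨hx, p, hp, he⟩

/-- Away from a null set, the gradient is a Borel map. -/
theorem exists_gradientMap (hc : IsConjugatePair P Q f g) (h : IsDualPair P Q) :
    ∃ (X : Set (Fin (d + 1) → ℝ)) (T : (Fin (d + 1) → ℝ) → (Fin (d + 1) → ℝ)),
      MeasurableSet X ∧ Measurable T ∧ P.probMeasure Xᶜ = 0 ∧
      ∀ x ∈ X, IsRegularPoint P Q f x ∧ gradientSet P Q f x = {T x} := by
  classical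
  obtain ⟨N, hN, hNm, hN0⟩ := exists_measurable_superset_of_null (ae_iff.1 (hc.ae_isRegularPoint h))
  have hreg : ∀ x ∈ Nᶜ, IsRegularPoint P Q f x := fun x hx => by
    by_contra hnr
    exact hx (hN hnr)
  have hex : ∀ x, ∃ p, x ∈ Nᶜ → gradientSet P Q f x = {p} := fun x => by
    by_cases hx : x ∈ Nᶜ
    · obtain ⟨p, hp⟩ := hc.exists_gradientSet_eq h (hreg x hx)
      exact ⟨p, fun _ => hp⟩
    · exact ⟨0, fun hx' => absurd hx' hx⟩
  choose T hT using hex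
  refine ⟨Nᶜ, Nᶜ.indicator T, hNm.compl, ?_, by rwa [compl_compl], fun x hx =>
    ⟨hreg x hx, by rw [indicator_of_mem hx]; exact hT x hx⟩⟩
  refine measurable_of_isClosed fun K hK => ?_
  -- At a regular point on `m`, the gradient is the only conjugate point in `H_m^+`, so membership
  -- in `K` becomes a closed condition on each face. On `N` the map is zero.
  have hset : Nᶜ.indicator T ⁻¹' K =
      (Nᶜ ∩ ⋃ m ∈ P.normals, {x ∈ P.face m | ∃ p ∈ Q.posFaces m ∩ K, g p + f x = x ⬝ᵥ p}) ∪
        (N ∩ {_x | (0 : Fin (d + 1) → ℝ) ∈ K}) := by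
    ext x
    by_cases hx : x ∈ N
    · simp [hx]
    · have hx' : x ∈ Nᶜ := hx
      simp only [mem_preimage, indicator_of_mem hx', mem_union, mem_inter_iff, hx', true_and, hx,
        false_and, or_false, mem_iUnion, exists_prop]
      obtain ⟨m, hm, hxm, huniq, -⟩ := hreg x hx'
      have hTx : T x ∈ gradientSet P Q f x := by rw [hT x hx']; rfl
      constructor
      · intro hK
        exact ⟨m, hm, hxm, T x, ⟨hTx.2 m hm hxm, hK⟩, (hc.mem_conjugateSet.1 hTx.1).2⟩
      · rintro ⟨m', hm', hxm', p, ⟨hp, hpK⟩, he⟩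
        have : p ∈ gradientSet P Q f x :=
          ⟨hc.mem_conjugateSet.2 ⟨IsDualPair.posFaces_subset_boundary Q m' hp, he⟩,
            fun m'' hm'' hxm'' => by
              rw [huniq m'' hm'' hxm'', ← huniq m' hm' hxm']; exact hp⟩
        rw [hT x hx'] at this
        rwa [← show p = T x from this]
  rw [hset]
  refine (hNm.compl.inter (h.finite_left.measurableSet_biUnion fun m _ => ?_)).union
    (hNm.inter (MeasurableSet.const _))
  refine (hc.isClosed_conj_preimage h (h.isCompact_face m) ?_).measurableSet
  exact (h.symm.isCompact_boundary.of_isClosed_subset (h.isClosed_posFaces m)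
    (IsDualPair.posFaces_subset_boundary Q m)).inter_right hK

end IsConjugatePair

end WeightedNormals

/-! ### Minimizers and the first variation. -/

namespace WeightedNormals

variable {d : ℕ} {P Q : WeightedNormals d}

theorem legendre_congr {φ φ' : (Fin (d + 1) → ℝ) → ℝ} (h : ∀ x ∈ P.boundary, φ x = φ' x) :
    P.legendre φ = P.legendre φ' := by
  ext p
  exact iSup_congr fun x => by rw [h x x.2]

theorem isGlobalConvex_congr {φ φ' : (Fin (d + 1) → ℝ) → ℝ}
    (he : ∀ x ∈ P.boundary, φ x = φ' x) (hφ : IsGlobalConvex P Q φ) : IsGlobalConvex P Q φ' := by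
  obtain ⟨ψ, hψ, h⟩ := hφ
  exact ⟨ψ, hψ, fun x hx => by rw [← he x hx, h x hx]⟩

namespace IsDualPair

variable {ψ : (Fin (d + 1) → ℝ) → ℝ} {C : ℝ}

theorem legendre_legendre_le (h : IsDualPair P Q) (hψ : ∀ p ∈ Q.boundary, |ψ p| ≤ C)
    {p : Fin (d + 1) → ℝ} (hp : p ∈ Q.boundary) : P.legendre (Q.legendre ψ) p ≤ ψ p :=
  h.symm.legendre_le fun x _ => by
    have := h.le_legendre hψ hp x
    rw [dotProduct_comm]; linarith

theorem integrable_of_continuous (h : IsDualPair P Q) {u : (Fin (d + 1) → ℝ) → ℝ}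
    (hu : Continuous u) : Integrable u P.probMeasure := by
  have := h.isProbabilityMeasure
  obtain ⟨C', hC'⟩ := h.isCompact_boundary.exists_bound_of_continuousOn hu.continuousOn
  exact Integrable.of_bound hu.aestronglyMeasurable C' (h.ae_mem_boundary.mono hC')

theorem integral_congr_boundary (h : IsDualPair P Q) {u u' : (Fin (d + 1) → ℝ) → ℝ}
    (he : ∀ x ∈ P.boundary, u x = u' x) : ∫ x, u x ∂P.probMeasure = ∫ x, u' x ∂P.probMeasure :=
  integral_congr_ae (h.ae_mem_boundary.mono he)

theorem functional_congr (h : IsDualPair P Q) {φ φ' : (Fin (d + 1) → ℝ) → ℝ}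
    (he : ∀ x ∈ P.boundary, φ x = φ' x) : functional P Q φ = functional P Q φ' := by
  rw [functional, functional, h.integral_congr_boundary he, legendre_congr he]

/-- A global convex function agrees on the boundary with its double Legendre transform. -/
theorem legendre_legendre_eq (h : IsDualPair P Q) {φ : (Fin (d + 1) → ℝ) → ℝ}
    (hφ : IsGlobalConvex P Q φ) : ∀ x ∈ P.boundary, φ x = Q.legendre (P.legendre φ) x := by
  obtain ⟨ψ, ⟨C, hψ⟩, hφψ⟩ := hφ
  obtain ⟨C', hC'⟩ := h.abs_legendre_le hψ
  rw [legendre_congr hφψ]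
  obtain ⟨C'', hC''⟩ := h.symm.abs_legendre_le hC'
  intro x hx
  rw [hφψ x hx]
  refine le_antisymm ?_ (h.symm.legendre_legendre_le hC' hx)
  refine h.legendre_le fun p hp => ?_
  have h1 := h.le_legendre hC'' hp x
  have h2 := h.legendre_legendre_le hψ hp
  linarith

theorem isConjugatePair_of_isGlobalConvex (h : IsDualPair P Q) {φ : (Fin (d + 1) → ℝ) → ℝ}
    (hφ : IsGlobalConvex P Q φ) :
    IsConjugatePair P Q (Q.legendre (P.legendre φ)) (P.legendre φ) := by
  have he := h.legendre_legendre_eq hφ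
  have hr : P.legendre φ = P.legendre (Q.legendre (P.legendre φ)) := legendre_congr he
  obtain ⟨ψ, ⟨C, hψ⟩, hφψ⟩ := hφ
  obtain ⟨C', hC'⟩ := h.abs_legendre_le hψ
  have hC : ∀ x ∈ P.boundary, |φ x| ≤ C' := fun x hx => by rw [hφψ x hx]; exact hC' x hx
  exact ⟨rfl, hr, ⟨C', fun x hx => by rw [← he x hx]; exact hC x hx⟩, h.symm.abs_legendre_le hC⟩

end IsDualPair

namespace IsConjugatePair

variable {f g : (Fin (d + 1) → ℝ) → ℝ}

/-- On conjugate pairs the two functionals have the same value, and any competitor may be replaced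
by its double transform. -/
theorem isMinimizer_symm (hc : IsConjugatePair P Q f g) (h : IsDualPair P Q)
    (hmin : IsMinimizer P Q f) : IsMinimizer Q P g := by
  obtain ⟨C, hC⟩ := hc.bounded_left
  refine ⟨⟨f, ⟨C, hC⟩, fun p _ => by rw [← hc.eq_right]⟩, fun φ' hφ' => ?_⟩
  have he := h.symm.legendre_legendre_eq hφ'
  obtain hc' := h.symm.isConjugatePair_of_isGlobalConvex hφ'
  obtain ⟨C', hC'⟩ := hc'.bounded_left
  set ξ := P.legendre (Q.legendre φ') with hξ
  rw [h.symm.functional_congr he]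
  have h1 : functional Q P ξ = functional P Q (Q.legendre φ') := by
    rw [functional, functional, ← hξ, ← hc'.eq_right, add_comm]
  have h2 : functional Q P g = functional P Q f := by
    rw [functional, functional, ← hc.eq_left, ← hc.eq_right, add_comm]
  rw [h1, h2]
  exact hmin.2 _ ⟨ξ, ⟨C', hC'⟩, fun x _ => by rw [← hc'.eq_right]⟩

/-- The first variation of the functional at a minimizer, for a compact set of conjugate points. -/
theorem measure_le_of_isCompact (hc : IsConjugatePair P Q f g) (h : IsDualPair P Q)
    (hmin : IsMinimizer P Q f) {K : Set (Fin (d + 1) → ℝ)} (hK : IsCompact K)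
    (hKQ : K ⊆ Q.boundary) :
    Q.probMeasure K ≤ P.probMeasure {x ∈ P.boundary | ∃ p ∈ K, p ∈ conjugateSet P Q f x} := by
  classical
  have hPp := h.isProbabilityMeasure
  have hQp := h.symm.isProbabilityMeasure
  rcases K.eq_empty_or_nonempty with rfl | hKne
  · simp
  have hf := hc.continuous h
  have hg := hc.symm.continuous h.symm
  obtain ⟨C, hC⟩ := hc.bounded_right
  -- Points where Young's inequality with some point of `K` has slack below `t`. Lowering `g` by `t`
  -- on `K` raises the transform by at most `t`, and only here.
  let V : ℝ → Set (Fin (d + 1) → ℝ) := fun t => {x | ∃ p ∈ K, g p + f x - x ⬝ᵥ p < t}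
  have hVo : ∀ t, IsOpen (V t) := fun t => by
    have : V t = ⋃ p ∈ K, {x | g p + f x - x ⬝ᵥ p < t} := by ext x; simp [V]
    rw [this]
    exact isOpen_biUnion fun p _ =>
      isOpen_lt ((continuous_const.add hf).sub (continuous_dot p)) continuous_const
  have hstep : ∀ t : ℝ, 0 < t → Q.probMeasure K ≤ P.probMeasure (V t) := by
    intro t ht
    let ψ : (Fin (d + 1) → ℝ) → ℝ := fun p => g p - K.indicator (fun _ => t) p
    have hind : ∀ p, 0 ≤ K.indicator (fun _ => t) p ∧ K.indicator (fun _ => t) p ≤ t := fun p => by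
      by_cases hp : p ∈ K <;> simp [hp, ht.le]
    have hψ : ∀ p ∈ Q.boundary, |ψ p| ≤ C + t := fun p hp => by
      have h1 := abs_le.1 (hC p hp)
      have h2 := hind p
      exact abs_le.2 ⟨by simp only [ψ]; linarith, by simp only [ψ]; linarith⟩
    have hu : ∀ x, Q.legendre ψ x ≤ f x + (V t).indicator (fun _ => t) x := by
      refine fun x => h.legendre_le fun p hp => ?_
      have hy := hc.young h hp x
      have h2 := hind p
      rw [dotProduct_comm x] at hy
      by_cases hx : x ∈ V t
      · simp only [hx, indicator_of_mem, ψ]; linarith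
      · by_cases hpK : p ∈ K
        · have : ¬ g p + f x - x ⬝ᵥ p < t := fun hlt => hx ⟨p, hpK, hlt⟩
          rw [dotProduct_comm x] at this
          simp only [hx, not_false_eq_true, indicator_of_notMem, ψ, hpK, indicator_of_mem]
          linarith
        · simp only [hx, not_false_eq_true, indicator_of_notMem, ψ, hpK]; linarith
    obtain ⟨C', hC'⟩ := h.abs_legendre_le hψ
    obtain ⟨L₁, hL₁⟩ := h.lipschitz_legendre hψ
    obtain ⟨L₂, hL₂⟩ := h.symm.lipschitz_legendre hC'
    have hKi : Integrable (K.indicator fun _ => t) Q.probMeasure :=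
      (integrable_const t).indicator hK.measurableSet
    have hVi : Integrable ((V t).indicator fun _ => t) P.probMeasure :=
      (integrable_const t).indicator (hVo t).measurableSet
    have hfun := hmin.2 (Q.legendre ψ) ⟨ψ, ⟨_, hψ⟩, fun _ _ => rfl⟩
    rw [functional, functional, ← hc.eq_right] at hfun
    have i1 : ∫ x, Q.legendre ψ x ∂P.probMeasure ≤
        ∫ x, f x ∂P.probMeasure + P.probMeasure.real (V t) * t := by
      calc _ ≤ ∫ x, (f x + (V t).indicator (fun _ => t) x) ∂P.probMeasure :=
            integral_mono (h.integrable_of_continuous hL₁.continuous)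
              ((h.integrable_of_continuous hf).add hVi) hu
        _ = _ := by
            rw [integral_add (h.integrable_of_continuous hf) hVi,
              integral_indicator_const _ (hVo t).measurableSet, smul_eq_mul]
    -- The double transform lies below `ψ`, so this part of the functional drops by at least `t
    -- |K|`.
    have i2 : ∫ p, P.legendre (Q.legendre ψ) p ∂Q.probMeasure ≤
        ∫ p, g p ∂Q.probMeasure - Q.probMeasure.real K * t := by
      calc _ ≤ ∫ p, (g p - K.indicator (fun _ => t) p) ∂Q.probMeasure :=
            integral_mono_ae (h.symm.integrable_of_continuous hL₂.continuous)
              ((h.symm.integrable_of_continuous hg).sub hKi)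
              (h.symm.ae_mem_boundary.mono fun p hp => h.legendre_legendre_le hψ hp)
        _ = _ := by
            rw [integral_sub (h.symm.integrable_of_continuous hg) hKi,
              integral_indicator_const _ hK.measurableSet, smul_eq_mul]
    have hreal : Q.probMeasure.real K ≤ P.probMeasure.real (V t) := by
      by_contra! hlt
      nlinarith
    exact (ENNReal.toReal_le_toReal (measure_ne_top _ _) (measure_ne_top _ _)).1 hreal
  have hlim := tendsto_measure_iInter_atTop (μ := P.probMeasure)
    (s := fun j : ℕ => V (1 / ((j : ℝ) + 1)) ∩ P.boundary)
    (fun j => ((hVo _).measurableSet.inter P.isClosed_boundary.measurableSet).nullMeasurableSet)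
    (fun i j hij => by
      rintro x ⟨⟨p, hp, hlt⟩, hx⟩
      exact ⟨⟨p, hp, hlt.trans_le (one_div_le_one_div_of_le (a := (i : ℝ) + 1) (by positivity) (by gcongr))⟩, hx⟩)
    ⟨0, measure_ne_top _ _⟩
  have hle : Q.probMeasure K ≤
      P.probMeasure (⋂ j : ℕ, V (1 / ((j : ℝ) + 1)) ∩ P.boundary) := by
    refine ge_of_tendsto' hlim fun j => ?_
    refine (hstep (1 / ((j : ℝ) + 1)) (by positivity)).trans (le_of_eq (measure_congr ?_))
    filter_upwards [h.ae_mem_boundary] with x hx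
    exact propext ⟨fun hV => ⟨hV, hx⟩, fun hV => hV.1⟩
  refine hle.trans (measure_mono fun x hx => ?_)
  rw [mem_iInter] at hx
  refine ⟨(hx 0).2, ?_⟩
  -- By compactness the infimum of the slack over `K` is attained; being below every `1 / (j + 1)`,
  -- it is zero.
  obtain ⟨p, hp, hpmin⟩ := hK.exists_isMinOn hKne (f := fun p => g p + f x - x ⬝ᵥ p)
    (by unfold dotProduct; fun_prop)
  refine ⟨p, hp, hc.mem_conjugateSet.2 ⟨hKQ hp, le_antisymm ?_ (hc.young h (hKQ hp) x)⟩⟩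
  by_contra! hlt
  obtain ⟨j, hj⟩ := exists_nat_one_div_lt (sub_pos.2 hlt)
  obtain ⟨⟨q, hq, hqlt⟩, -⟩ := hx j
  have := hpmin hq
  simp only [mem_ofPred_eq] at this
  linarith

/-- Inner regularity passes from compact to Borel sets. -/
theorem measure_le_conj (hc : IsConjugatePair P Q f g) (h : IsDualPair P Q)
    (hmin : IsMinimizer P Q f) {F : Set (Fin (d + 1) → ℝ)} (hF : MeasurableSet F)
    (hFQ : F ⊆ Q.boundary) :
    Q.probMeasure F ≤ P.probMeasure {x ∈ P.boundary | ∃ p ∈ F, p ∈ conjugateSet P Q f x} := by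
  have hQp := h.symm.isProbabilityMeasure
  rw [hF.measure_eq_iSup_isCompact]
  refine iSup₂_le fun K hKF => iSup_le fun hK => ?_
  refine (hc.measure_le_of_isCompact h hmin hK (hKF.trans hFQ)).trans (measure_mono ?_)
  rintro x ⟨hx, p, hp, hpx⟩
  exact ⟨hx, p, hKF hp, hpx⟩

end IsConjugatePair

end WeightedNormals

/-! ### A strict Hahn decomposition for arbitrary sets. -/

section Hahn

variable {α : Type*} [MeasurableSpace α]

/-- A Hahn decomposition that is strict on the positive set. -/
theorem exists_strict_hahn (μ ν : Measure α) [IsFiniteMeasure μ] [IsFiniteMeasure ν] :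
    ∃ N, MeasurableSet N ∧ (∀ H ⊆ N, ν H ≤ μ H → μ H = 0) ∧ ∀ H ⊆ Nᶜ, ν H ≤ μ H := by
  have hdec := ν.haveLebesgueDecomposition_add μ
  have hs := ν.mutuallySingular_singularPart μ
  have hr := Measure.measurable_rnDeriv ν μ
  set r := ν.rnDeriv μ
  -- A carrier of the part of `ν` singular to `μ`, together with the points of density strictly
  -- above one. The strict inequality gives strictness on `N`.
  set N := hs.nullSetᶜ ∪ {x | 1 < r x} with hN
  have hNm : MeasurableSet N :=
    hs.measurableSet_nullSet.compl.union (measurableSet_lt measurable_const hr)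
  have hpos : ∀ H ⊆ N, MeasurableSet H → ν H ≤ μ H → μ H = 0 := by
    intro H hHN hH hle
    have hgt : ∀ᵐ x ∂μ.restrict H, 1 < r x := by
      rw [ae_restrict_iff' hH]
      filter_upwards [measure_eq_zero_iff_ae_notMem.1 hs.measure_compl_nullSet] with x hx hxH
      exact (hHN hxH).resolve_left hx
    have hint : ∫⁻ x in H, r x ∂μ ≤ ∫⁻ _ in H, 1 ∂μ := by
      rw [setLIntegral_one]
      refine le_trans ?_ hle
      conv_rhs => rw [hdec]
      rw [Measure.add_apply, withDensity_apply _ hH]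
      exact le_add_self
    -- A density above one whose integral is at most `μ H < ∞` must equal one almost everywhere,
    -- which is absurd unless `μ H = 0`.
    have heq := ae_eq_of_ae_le_of_lintegral_le (hgt.mono fun x hx => hx.le)
      (by rw [setLIntegral_one]; exact measure_ne_top _ _) hr.aemeasurable hint
    have hfalse : ∀ᵐ x ∂μ.restrict H, False := by
      filter_upwards [hgt, heq] with x h1 h2
      rw [← h2] at h1
      exact lt_irrefl _ h1
    rw [Filter.eventually_false_iff_eq_bot, ae_eq_bot, Measure.restrict_eq_zero] at hfalse
    exact hfalse
  have hneg : ∀ H ⊆ Nᶜ, MeasurableSet H → ν H ≤ μ H := by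
    intro H hHN hH
    conv_lhs => rw [hdec]
    rw [Measure.add_apply, withDensity_apply _ hH,
      measure_mono_null (t := hs.nullSet) (fun x hx => ?_) hs.measure_nullSet, zero_add]
    · calc _ ≤ ∫⁻ _ in H, 1 ∂μ := setLIntegral_mono' hH fun x hx =>
            not_lt.1 fun h1 => hHN hx (Or.inr h1)
        _ = μ H := setLIntegral_one _
    · by_contra hx'
      exact hHN hx (Or.inl hx')
  refine ⟨N, hNm, fun H hHN hle => ?_, fun H hHN => ?_⟩
  -- A measurable hull for the larger side of each inequality, cut down to the decomposition set,
  -- extends the claim to outer measures.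
  · have hsub : H ⊆ toMeasurable ν H ∩ N := subset_inter (subset_toMeasurable _ _) hHN
    refine measure_mono_null hsub
      (hpos _ inter_subset_right ((measurableSet_toMeasurable _ _).inter hNm) ?_)
    calc _ ≤ ν (toMeasurable ν H) := measure_mono inter_subset_left
      _ = ν H := measure_toMeasurable _
      _ ≤ μ H := hle
      _ ≤ _ := measure_mono hsub
  · have hsub : H ⊆ toMeasurable μ H ∩ Nᶜ := subset_inter (subset_toMeasurable _ _) hHN
    calc ν H ≤ ν (toMeasurable μ H ∩ Nᶜ) := measure_mono hsub
      _ ≤ μ (toMeasurable μ H ∩ Nᶜ) :=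
        hneg _ inter_subset_right ((measurableSet_toMeasurable _ _).inter hNm.compl)
      _ ≤ μ (toMeasurable μ H) := measure_mono inter_subset_left
      _ = μ H := measure_toMeasurable _

end Hahn

/-! ### A null bad set makes the gradient transport the measure. -/

namespace WeightedNormals

variable {d : ℕ} {P Q : WeightedNormals d}

/-- `T` is a Borel map which represents the gradient of `f` on the conull Borel set `X` of regular
points. -/
structure IsGradientMap (P Q : WeightedNormals d) (f : (Fin (d + 1) → ℝ) → ℝ)
    (X : Set (Fin (d + 1) → ℝ)) (T : (Fin (d + 1) → ℝ) → (Fin (d + 1) → ℝ)) : Prop where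
  measurableSet : MeasurableSet X
  measurable : Measurable T
  measure_compl : P.probMeasure Xᶜ = 0
  isRegularPoint : ∀ x ∈ X, IsRegularPoint P Q f x
  gradientSet_eq : ∀ x ∈ X, gradientSet P Q f x = {T x}

/-- Comparison of two sets on an entry face and an exit face of the lines in direction `n`. -/
theorem IsDualPair.probMeasure_le_of_lineProj (h : IsDualPair P Q) {m m' n : Fin (d + 1) → ℝ}
    (hm : m ∈ P.normals) (hm' : m' ∈ P.normals) (hn : n ∈ Q.normals) (hneg : m ⬝ᵥ n < 0)
    (hone : m' ⬝ᵥ n = 1) {A A' : Set (Fin (d + 1) → ℝ)} (hA : A ⊆ P.face m) (hA' : A' ⊆ P.face m')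
    (hsub : lineProj n '' A ⊆ lineProj n '' A') : P.probMeasure A ≤ P.probMeasure A' := by
  refine probMeasure_le_of_boundaryMeasure_le ?_
  rw [h.boundaryMeasure_eq_faceMeasure hm hA, h.boundaryMeasure_eq_faceMeasure hm' hA']
  have h1 := h.dot_le_neg_one_of_neg hm hn hneg
  rw [dotProduct_comm] at hone h1
  have e := h.volume_lineProj_image hm hn (by linarith) hA
  have e' := h.volume_lineProj_image hm' hn (by rw [hone]; exact one_ne_zero) hA'
  rw [hone] at e'
  simp only [abs_one, ENNReal.ofReal_one, one_mul] at e'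
  calc P.faceMeasure m A = 1 * P.faceMeasure m A := (one_mul _).symm
    _ ≤ ENNReal.ofReal |n ⬝ᵥ m| * P.faceMeasure m A := by
        gcongr
        rw [ENNReal.one_le_ofReal, abs_of_neg (by linarith)]
        linarith
    _ ≤ P.faceMeasure m' A' := by rw [← e, ← e']; exact measure_mono hsub

namespace IsGradientMap

variable {f g : (Fin (d + 1) → ℝ) → ℝ} {X Y : Set (Fin (d + 1) → ℝ)}
  {T S : (Fin (d + 1) → ℝ) → (Fin (d + 1) → ℝ)}

theorem mem_boundary (hX : IsGradientMap P Q f X T) {x : Fin (d + 1) → ℝ} (hx : x ∈ X) :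
    x ∈ P.boundary := by
  obtain ⟨m, -, hxm, -⟩ := hX.isRegularPoint x hx
  exact hxm.1

theorem mem_gradientSet (hX : IsGradientMap P Q f X T) {x : Fin (d + 1) → ℝ} (hx : x ∈ X) :
    T x ∈ gradientSet P Q f x := by
  rw [hX.gradientSet_eq x hx]; rfl

theorem eq_of_mem (hX : IsGradientMap P Q f X T) {x p : Fin (d + 1) → ℝ} (hx : x ∈ X)
    (hp : p ∈ gradientSet P Q f x) : p = T x := by
  rw [hX.gradientSet_eq x hx] at hp; exact hp

theorem measure_inter (hX : IsGradientMap P Q f X T) (E : Set (Fin (d + 1) → ℝ)) :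
    P.probMeasure (E ∩ X) = P.probMeasure E :=
  measure_inter_conull hX.measure_compl

/-- A gradient `p` of `f` at `x` which is a regular point satisfies `S p = x`. -/
theorem swap (hc : IsConjugatePair P Q f g) (h : IsDualPair P Q) (hY : IsGradientMap Q P g Y S)
    {x p : Fin (d + 1) → ℝ} (hx : x ∈ P.boundary) (hp : p ∈ gradientSet P Q f x) (hpY : p ∈ Y) :
    S p = x := by
  obtain ⟨n, hn, hpn, huniq, -⟩ := hY.isRegularPoint p hpY
  obtain ⟨m, hm, hxm⟩ := h.exists_face hx
  obtain ⟨n', hn', h1, hpn'⟩ := hp.2 m hm hxm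
  -- As `p` lies only on `n`, the gradient condition gives `⟨n, m⟩ = 1`, which is also the condition
  -- for `x` to be a gradient at `p`.
  rw [huniq n' hn' hpn'] at h1
  refine (hY.eq_of_mem hpY ⟨hc.mem_conjugateSet_symm hx hp.1, fun n'' hn'' hpn'' => ?_⟩).symm
  rw [huniq n'' hn'' hpn'']
  exact ⟨m, hm, by rw [dotProduct_comm]; exact h1, hxm⟩

/-- Write `ν = S_* dp`, let `A` be the exceptional points `x` and `R` their partners `p`. Shadows
along `n` give `|A| ≤ |S(R)|`, shadows along `m` give `|R| ≤ |T(A)|`. Since `S` and `T` invert each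
other at regular points, `ν(S(R)) ≤ |R| ≤ |T(A)| ≤ ν(A) ≤ |A| ≤ |S(R)|`, where `ν(A) ≤ |A|` holds
because `A` avoids `N`. But `S(R) ⊆ N`, so strictness forces `|S(R)| = 0`, hence `|A| = 0`. -/
theorem measure_negative_pairs (hc : IsConjugatePair P Q f g) (h : IsDualPair P Q)
    (hX : IsGradientMap P Q f X T) (hY : IsGradientMap Q P g Y S) {N : Set (Fin (d + 1) → ℝ)}
    (hpos : ∀ H ⊆ N, Measure.map S Q.probMeasure H ≤ P.probMeasure H → P.probMeasure H = 0)
    (hneg : ∀ H ⊆ Nᶜ, Measure.map S Q.probMeasure H ≤ P.probMeasure H)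
    {m n : Fin (d + 1) → ℝ} (hm : m ∈ P.normals) (hn : n ∈ Q.normals) (hmn : m ⬝ᵥ n < 0) :
    P.probMeasure {x ∈ X \ N | x ∈ P.face m ∧ ∃ p ∈ Y ∩ S ⁻¹' N, p ∈ Q.face n ∧
      p ∈ conjugateSet P Q f x} = 0 := by
  have hlineS : ∀ {x p}, x ∈ P.boundary → p ∈ Y → p ∈ Q.face n → p ∈ conjugateSet P Q f x →
      lineProj n (S p) = lineProj n x := by
    intro x p hx hpY hpn hpx
    obtain ⟨n', hn', hpn', huniq, hline⟩ := hY.isRegularPoint p hpY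
    rw [huniq n hn hpn]
    exact hline _ (hY.mem_gradientSet hpY).1 _ (hc.mem_conjugateSet_symm hx hpx)
  have hlineT : ∀ {x p}, x ∈ X → x ∈ P.face m → p ∈ conjugateSet P Q f x →
      lineProj m (T x) = lineProj m p := by
    intro x p hx hxm hpx
    obtain ⟨m', hm', hxm', huniq, hline⟩ := hX.isRegularPoint x hx
    rw [huniq m hm hxm]
    exact hline _ (hX.mem_gradientSet hx).1 _ hpx
  have hsplit : {x ∈ X \ N | x ∈ P.face m ∧ ∃ p ∈ Y ∩ S ⁻¹' N, p ∈ Q.face n ∧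
        p ∈ conjugateSet P Q f x} ⊆
      ⋃ m' ∈ {m' ∈ P.normals | m' ⬝ᵥ n = 1}, ⋃ n' ∈ {n' ∈ Q.normals | n' ⬝ᵥ m = 1},
        ({x ∈ X | x ∈ P.face m ∧ ∃ p ∈ Y, p ∈ Q.face n ∧ p ∈ conjugateSet P Q f x ∧
            S p ∈ P.face m' ∧ S p ∉ X} ∪
          {x ∈ X \ N | x ∈ P.face m ∧ T x ∈ Q.face n' ∧ ∃ p ∈ Y ∩ S ⁻¹' N, p ∈ Q.face n ∧
            p ∈ conjugateSet P Q f x ∧ S p ∈ P.face m' ∧ S p ∈ X}) := by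
    rintro x ⟨hxX, hxm, p, hp, hpn, hpx⟩
    obtain ⟨m', hm', h1, hSm'⟩ := (hY.mem_gradientSet hp.1).2 n hn hpn
    obtain ⟨n', hn', h1', hTn'⟩ := (hX.mem_gradientSet hxX.1).2 m hm hxm
    refine mem_biUnion (show m' ∈ {m' ∈ P.normals | m' ⬝ᵥ n = 1} from ⟨hm', h1⟩)
      (mem_biUnion (show n' ∈ {n' ∈ Q.normals | n' ⬝ᵥ m = 1} from ⟨hn', h1'⟩) ?_)
    by_cases hS : S p ∈ X
    · exact Or.inr ⟨hxX, hxm, hTn', p, hp, hpn, hpx, hSm', hS⟩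
    · exact Or.inl ⟨hxX.1, hxm, p, hp.1, hpn, hpx, hSm', hS⟩
  refine measure_mono_null hsplit ?_
  rw [measure_biUnion_null_iff (h.finite_left.subset (sep_subset _ _)).countable]
  rintro m' ⟨hm', hm'n⟩
  rw [measure_biUnion_null_iff (h.finite_right.subset (sep_subset _ _)).countable]
  rintro n' ⟨hn', hn'm⟩
  refine measure_union_null ?_ ?_
  -- If `S p` is not regular, the shadow along `n` is covered by that of a null set in an exit face,
  -- which dominates the measure.
  · rw [← nonpos_iff_eq_zero]
    refine (h.probMeasure_le_of_lineProj hm hm' hn hmn hm'n (A' := P.face m' \ X)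
      (fun x hx => hx.2.1) sdiff_subset ?_).trans
      ((measure_mono (t := Xᶜ) fun x hx => hx.2).trans hX.measure_compl.le)
    rintro _ ⟨x, ⟨hxX, hxm, p, hpY, hpn, hpx, hSm', hS⟩, rfl⟩
    exact ⟨S p, ⟨hSm', hS⟩, hlineS hxm.1 hpY hpn hpx⟩
  · set A := {x ∈ X \ N | x ∈ P.face m ∧ T x ∈ Q.face n' ∧ ∃ p ∈ Y ∩ S ⁻¹' N, p ∈ Q.face n ∧
      p ∈ conjugateSet P Q f x ∧ S p ∈ P.face m' ∧ S p ∈ X}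
    let R := {p ∈ Y ∩ S ⁻¹' N | p ∈ Q.face n ∧ S p ∈ P.face m' ∧ S p ∈ X ∧
      ∃ x ∈ A, p ∈ conjugateSet P Q f x}
    have h1 : P.probMeasure A ≤ P.probMeasure (S '' R) := by
      refine h.probMeasure_le_of_lineProj hm hm' hn hmn hm'n (fun x hx => hx.2.1) ?_ ?_
      · rintro _ ⟨p, hp, rfl⟩
        exact hp.2.2.1
      · rintro _ ⟨x, hx, rfl⟩
        obtain ⟨hxX, hxm, hTx, p, hp, hpn, hpx, hSm', hS⟩ := id hx
        exact ⟨S p, ⟨p, ⟨hp, hpn, hSm', hS, x, hx, hpx⟩, rfl⟩, hlineS hxm.1 hp.1 hpn hpx⟩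
    have h2 : Q.probMeasure R ≤ Q.probMeasure (T '' A) := by
      refine h.symm.probMeasure_le_of_lineProj hn hn' hm (by rwa [dotProduct_comm]) hn'm
        (fun p hp => hp.2.1) ?_ ?_
      · rintro _ ⟨x, hx, rfl⟩
        exact hx.2.2.1
      · rintro _ ⟨p, ⟨-, -, -, -, x, hx, hpx⟩, rfl⟩
        exact ⟨T x, ⟨x, hx, rfl⟩, hlineT hx.1.1 hx.2.1 hpx⟩
    have h3 : Q.probMeasure (T '' A) ≤ Measure.map S Q.probMeasure A := by
      rw [← hY.measure_inter]
      refine le_trans (measure_mono ?_) (Measure.le_map_apply hY.measurable.aemeasurable A)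
      rintro _ ⟨⟨x, hx, rfl⟩, hY'⟩
      rw [mem_preimage, swap hc h hY hx.2.1.1 (hX.mem_gradientSet hx.1.1) hY']
      exact hx
    have h4 : Measure.map S Q.probMeasure A ≤ P.probMeasure A := hneg A fun x hx => hx.1.2
    -- `S '' R` need not be measurable, so it is enclosed in the regular points that `T` sends into
    -- a measurable hull of `R`.
    have h5 : Measure.map S Q.probMeasure (S '' R) ≤ Q.probMeasure R := by
      have hW := measurableSet_toMeasurable Q.probMeasure R
      have hTS : ∀ p ∈ Y, S p ∈ X → T (S p) = p := fun p hpY hS =>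
        swap hc.symm h.symm hX (hY.mem_boundary hpY) (hY.mem_gradientSet hpY) hS
      calc _ ≤ Measure.map S Q.probMeasure (X ∩ T ⁻¹' toMeasurable Q.probMeasure R) := by
            refine measure_mono ?_
            rintro _ ⟨p, hp, rfl⟩
            refine ⟨hp.2.2.2.1, ?_⟩
            rw [mem_preimage, hTS p hp.1.1 hp.2.2.2.1]
            exact subset_toMeasurable _ _ hp
        _ = Q.probMeasure (S ⁻¹' (X ∩ T ⁻¹' toMeasurable Q.probMeasure R)) :=
            Measure.map_apply hY.measurable (hX.measurableSet.inter (hX.measurable hW))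
        _ = Q.probMeasure (S ⁻¹' (X ∩ T ⁻¹' toMeasurable Q.probMeasure R) ∩ Y) :=
            (hY.measure_inter _).symm
        _ ≤ Q.probMeasure (toMeasurable Q.probMeasure R) := by
            refine measure_mono ?_
            rintro p ⟨⟨hS, hT⟩, hpY⟩
            rwa [mem_preimage, hTS p hpY hS] at hT
        _ = _ := measure_toMeasurable _
    have hle : Measure.map S Q.probMeasure (S '' R) ≤ P.probMeasure (S '' R) :=
      h5.trans (h2.trans (h3.trans (h4.trans h1)))
    have hz := hpos (S '' R) (by rintro _ ⟨p, hp, rfl⟩; exact hp.1.2) hle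
    exact le_antisymm (h1.trans hz.le) zero_le

/-- If the bad set is null, the gradient map transports the measure. -/
theorem map_eq (hc : IsConjugatePair P Q f g) (h : IsDualPair P Q)
    (hX : IsGradientMap P Q f X T) (hY : IsGradientMap Q P g Y S) (hmin : IsMinimizer P Q f)
    (hbad : Q.probMeasure (badSet Q P g) = 0) : Measure.map S Q.probMeasure = P.probMeasure := by
  have hPp := h.isProbabilityMeasure
  have hQp := h.symm.isProbabilityMeasure
  have hνp : IsProbabilityMeasure (Measure.map S Q.probMeasure) :=
    Measure.isProbabilityMeasure_map hY.measurable.aemeasurable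
  obtain ⟨N, hNm, hpos, hneg⟩ := exists_strict_hahn P.probMeasure (Measure.map S Q.probMeasure)
  obtain ⟨B, hB, hBm, hB0⟩ := exists_measurable_superset_of_null hbad
  let Z : Set (Fin (d + 1) → ℝ) := ⋃ m ∈ P.normals, ⋃ n ∈ {n ∈ Q.normals | m ⬝ᵥ n < 0},
    {x ∈ X \ N | x ∈ P.face m ∧ ∃ p ∈ Y ∩ S ⁻¹' N, p ∈ Q.face n ∧ p ∈ conjugateSet P Q f x}
  have hZ : P.probMeasure Z = 0 := by
    rw [measure_biUnion_null_iff h.finite_left.countable]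
    intro m hm
    rw [measure_biUnion_null_iff (h.finite_right.subset (sep_subset _ _)).countable]
    rintro n ⟨hn, hmn⟩
    exact measure_negative_pairs hc h hX hY hpos hneg hm hn hmn
  -- The first variation is applied to `S⁻¹ N` without the bad set. A regular conjugate point
  -- outside `N` is not `S p`, so the pair is not a gradient pair; the sign of `⟨m, n⟩` then places
  -- it in `Z`, in the bad set, or in contradiction.
  have hN : Measure.map S Q.probMeasure N ≤ P.probMeasure N := by
    rw [Measure.map_apply hY.measurable hNm]
    calc Q.probMeasure (S ⁻¹' N) = Q.probMeasure (S ⁻¹' N ∩ Y) := (hY.measure_inter _).symm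
      _ = Q.probMeasure ((S ⁻¹' N ∩ Y) \ B) := (measure_sdiff_null hB0).symm
      _ ≤ P.probMeasure {x ∈ P.boundary | ∃ p ∈ (S ⁻¹' N ∩ Y) \ B, p ∈ conjugateSet P Q f x} :=
          hc.measure_le_conj h hmin (((hY.measurable hNm).inter hY.measurableSet).diff hBm)
            fun p hp => hY.mem_boundary hp.1.2
      _ = P.probMeasure ({x ∈ P.boundary | ∃ p ∈ (S ⁻¹' N ∩ Y) \ B,
            p ∈ conjugateSet P Q f x} ∩ X) := (hX.measure_inter _).symm
      _ ≤ P.probMeasure (N ∪ Z) := by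
          refine measure_mono ?_
          rintro x ⟨⟨hxb, p, ⟨⟨hSp, hpY⟩, hpB⟩, hpx⟩, hxX⟩
          by_contra hcon
          rw [mem_union, not_or] at hcon
          obtain ⟨hxN, hxZ⟩ := hcon
          obtain ⟨m, hm, hxm, hmu, -⟩ := hX.isRegularPoint x hxX
          obtain ⟨n, hn, hpn, hnu, -⟩ := hY.isRegularPoint p hpY
          have hxp := hc.mem_conjugateSet_symm hxb hpx
          have hng : x ∉ gradientSet Q P g p := fun hgr => hxN (by
            rw [hY.eq_of_mem hpY hgr]; exact hSp)
          rcases lt_trichotomy (m ⬝ᵥ n) 0 with hlt | heq | hgt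
          · exact hxZ (mem_biUnion hm (mem_biUnion
              (show n ∈ {n ∈ Q.normals | m ⬝ᵥ n < 0} from ⟨hn, hlt⟩)
              ⟨⟨hxX, hxN⟩, hxm, p, ⟨hpY, hSp⟩, hpn, hpx⟩))
          · exact hpB (hB ⟨n, hn, hpn, m, hm, by rw [dotProduct_comm]; exact heq, x, hxm, hxp, hng⟩)
          · refine hng ⟨hxp, fun n' hn' hpn' => ?_⟩
            rw [hnu n' hn' hpn']
            exact ⟨m, hm, h.dot_eq_one_of_pos hm hn hgt, hxm⟩
      _ ≤ P.probMeasure N + P.probMeasure Z := measure_union_le _ _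
      _ = P.probMeasure N := by rw [hZ, add_zero]
  -- Strictness makes `N` null for both measures, so the image measure is dominated everywhere;
  -- equal total mass gives equality.
  have hPN := hpos N subset_rfl hN
  have hνN : Measure.map S Q.probMeasure N = 0 := le_antisymm (hN.trans hPN.le) zero_le
  have hle : Measure.map S Q.probMeasure ≤ P.probMeasure := by
    refine Measure.le_iff'.2 fun H => ?_
    calc _ ≤ Measure.map S Q.probMeasure (N ∪ (H ∩ Nᶜ)) := measure_mono fun x hx => by
          by_cases hxN : x ∈ N
          · exact Or.inl hxN
          · exact Or.inr ⟨hx, hxN⟩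
      _ ≤ Measure.map S Q.probMeasure N + Measure.map S Q.probMeasure (H ∩ Nᶜ) :=
          measure_union_le _ _
      _ ≤ 0 + P.probMeasure (H ∩ Nᶜ) := add_le_add hνN.le (hneg _ inter_subset_right)
      _ ≤ P.probMeasure H := by rw [zero_add]; exact measure_mono inter_subset_left
  exact Measure.eq_of_le_of_measure_univ_eq hle (by simp)

end IsGradientMap

end WeightedNormals

/-! ### Consequences of measure transport. -/

namespace WeightedNormals

variable {d : ℕ} {P Q : WeightedNormals d} {f g : (Fin (d + 1) → ℝ) → ℝ}
  {X Y : Set (Fin (d + 1) → ℝ)} {T S : (Fin (d + 1) → ℝ) → (Fin (d + 1) → ℝ)}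

namespace IsGradientMap

/-- The conjugate points of a regular `p` differ by multiples of `n`. As `n` is orthogonal to `m`,
they lie on the hyperplane of `m` together, so the actual gradient lies on the orthogonal face too.
-/
theorem exists_face_of_mem_badSet (h : IsDualPair P Q) (hY : IsGradientMap Q P g Y S)
    {p : Fin (d + 1) → ℝ} (hp : p ∈ Y) (hbad : p ∈ badSet Q P g) :
    ∃ n ∈ Q.normals, p ∈ Q.face n ∧ ∃ m ∈ P.normals, n ⬝ᵥ m = 0 ∧ S p ∈ P.face m := by
  obtain ⟨n, hn, hpn, m, hm, hnm, x, hxm, hxp, -⟩ := hbad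
  obtain ⟨n', hn', hpn', huniq, hline⟩ := hY.isRegularPoint p hp
  have hSp := (hY.mem_gradientSet hp).1
  have hl := hline x hxp (S p) hSp
  rw [← huniq n hn hpn] at hl
  obtain ⟨s, hs⟩ := (lineProj_eq_iff (h.isPrimitive_right hn)).1 hl
  refine ⟨n, hn, hpn, m, hm, hnm, hSp.1, ?_⟩
  rw [hs, add_dotProduct, smul_dotProduct, hnm, hxm.2]; simp

/-- The gradient maps of a conjugate pair that are inverse to each other and measure preserving. -/
structure IsTransport (P Q : WeightedNormals d) (f g : (Fin (d + 1) → ℝ) → ℝ)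
    (X Y : Set (Fin (d + 1) → ℝ)) (T S : (Fin (d + 1) → ℝ) → (Fin (d + 1) → ℝ)) : Prop where
  dual : IsDualPair P Q
  conj : IsConjugatePair P Q f g
  left : IsGradientMap P Q f X T
  right : IsGradientMap Q P g Y S
  map_right : Measure.map S Q.probMeasure = P.probMeasure
  map_left : Measure.map T P.probMeasure = Q.probMeasure

/-- The image identity sends almost every `p` to a regular point, where `T (S p) = p`; so `T` pushes
the measure back. -/
theorem isTransport_of_map_eq (h : IsDualPair P Q) (hc : IsConjugatePair P Q f g)
    (hX : IsGradientMap P Q f X T) (hY : IsGradientMap Q P g Y S)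
    (hν : Measure.map S Q.probMeasure = P.probMeasure) : IsTransport P Q f g X Y T S := by
  refine ⟨h, hc, hX, hY, hν, ?_⟩
  have hS0 : Q.probMeasure (S ⁻¹' X)ᶜ = 0 := by
    rw [← preimage_compl, ← Measure.map_apply hY.measurable hX.measurableSet.compl, hν]
    exact hX.measure_compl
  ext H hH
  rw [Measure.map_apply hX.measurable hH, ← hν, Measure.map_apply hY.measurable (hX.measurable hH)]
  refine measure_congr ?_
  filter_upwards [measure_eq_zero_iff_ae_notMem.1 hS0,
    measure_eq_zero_iff_ae_notMem.1 hY.measure_compl] with p hp hpY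
  rw [notMem_compl_iff] at hp hpY
  have := swap hc.symm h.symm hX (hY.mem_boundary hpY) (hY.mem_gradientSet hpY) hp
  refine propext ?_
  change T (S p) ∈ H ↔ p ∈ H
  rw [this]

namespace IsTransport

theorem symm (ht : IsTransport P Q f g X Y T S) : IsTransport Q P g f Y X S T :=
  ⟨ht.dual.symm, ht.conj.symm, ht.right, ht.left, ht.map_left, ht.map_right⟩

theorem ae_mem (ht : IsTransport P Q f g X Y T S) : ∀ᵐ x ∂P.probMeasure, x ∈ X ∧ T x ∈ Y := by
  have h0 : P.probMeasure (T ⁻¹' Yᶜ) = 0 := by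
    rw [← Measure.map_apply ht.left.measurable ht.right.measurableSet.compl, ht.map_left]
    exact ht.right.measure_compl
  filter_upwards [measure_eq_zero_iff_ae_notMem.1 h0,
    measure_eq_zero_iff_ae_notMem.1 ht.left.measure_compl] with x hx hxX
  exact ⟨not_not.1 hxX, not_not.1 hx⟩

theorem right_left (ht : IsTransport P Q f g X Y T S) {x : Fin (d + 1) → ℝ} (hx : x ∈ X)
    (hTx : T x ∈ Y) : S (T x) = x :=
  swap ht.conj ht.dual ht.right (ht.left.mem_boundary hx) (ht.left.mem_gradientSet hx) hTx

/-- For a bad regular `x`, the point `T x` lies on a face with normal orthogonal to `m` and also on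
one with pairing one; for regular `T x` these are the same face. -/
theorem measure_badSet (ht : IsTransport P Q f g X Y T S) : P.probMeasure (badSet P Q f) = 0 := by
  rw [measure_eq_zero_iff_ae_notMem]
  filter_upwards [ht.ae_mem] with x ⟨hx, hTx⟩ hbad
  obtain ⟨m, hm, hxm, n, hn, hmn, hTn⟩ :=
    exists_face_of_mem_badSet ht.dual.symm ht.left hx hbad
  obtain ⟨n', hn', h1, hTn'⟩ := (ht.left.mem_gradientSet hx).2 m hm hxm
  obtain ⟨n'', -, -, huniq, -⟩ := ht.right.isRegularPoint _ hTx
  rw [huniq n' hn' hTn', ← huniq n hn hTn, dotProduct_comm, hmn] at h1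
  exact zero_ne_one h1

theorem ae_mem_gradientImage (ht : IsTransport P Q f g X Y T S) :
    ∀ᵐ x ∂P.probMeasure, x ∈ gradientImage Q P g Q.boundary := by
  filter_upwards [ht.ae_mem] with x ⟨hx, hTx⟩
  refine ⟨T x, ht.right.mem_boundary hTx, ?_⟩
  have := ht.right.mem_gradientSet hTx
  rwa [ht.right_left hx hTx] at this

theorem gradientSet_symm (ht : IsTransport P Q f g X Y T S) {x : Fin (d + 1) → ℝ} (hx : x ∈ X)
    (hTx : T x ∈ Y) : gradientSet Q P g (T x) = {x} := by
  rw [ht.right.gradientSet_eq _ hTx, ht.right_left hx hTx]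

theorem ae_gradientSet (ht : IsTransport P Q f g X Y T S) :
    ∀ᵐ x ∂P.probMeasure, ∃ p, gradientSet P Q f x = {p} ∧ gradientSet Q P g p = {x} := by
  filter_upwards [ht.ae_mem] with x ⟨hx, hTx⟩
  exact ⟨T x, ht.left.gradientSet_eq x hx, ht.gradientSet_symm hx hTx⟩

theorem mem_gradientImage_iff (ht : IsTransport P Q f g X Y T S) {F : Set (Fin (d + 1) → ℝ)}
    (hF : F ⊆ Q.boundary) {x : Fin (d + 1) → ℝ} (hx : x ∈ X) (hTx : T x ∈ Y) :
    x ∈ gradientImage Q P g F ↔ T x ∈ F := by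
  constructor
  · rintro ⟨p, hp, hxp⟩
    rwa [swap ht.conj.symm ht.dual.symm ht.left (hF hp) hxp hx]
  · intro hF'
    refine ⟨T x, hF', ?_⟩
    rw [ht.gradientSet_symm hx hTx]; rfl

theorem gradientImage_ae_eq (ht : IsTransport P Q f g X Y T S) {F : Set (Fin (d + 1) → ℝ)}
    (hF : F ⊆ Q.boundary) : gradientImage Q P g F =ᵐ[P.probMeasure] T ⁻¹' F := by
  filter_upwards [ht.ae_mem] with x ⟨hx, hTx⟩
  exact propext (ht.mem_gradientImage_iff hF hx hTx)

theorem nullMeasurableSet_gradientImage (ht : IsTransport P Q f g X Y T S)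
    {F : Set (Fin (d + 1) → ℝ)} (hF : F ⊆ Q.boundary) (hFm : NullMeasurableSet F Q.probMeasure) :
    NullMeasurableSet (gradientImage Q P g F) P.probMeasure := by
  have hT : MeasurePreserving T P.probMeasure Q.probMeasure := ⟨ht.left.measurable, ht.map_left⟩
  exact (hFm.preimage hT.quasiMeasurePreserving).congr (ht.gradientImage_ae_eq hF).symm

theorem measure_gradientImage (ht : IsTransport P Q f g X Y T S) {F : Set (Fin (d + 1) → ℝ)}
    (hF : F ⊆ Q.boundary) : P.probMeasure (gradientImage Q P g F) = Q.probMeasure F := by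
  rw [measure_congr (ht.gradientImage_ae_eq hF)]
  refine le_antisymm ?_ ?_
  · conv_rhs => rw [← ht.map_left]
    exact Measure.le_map_apply ht.left.measurable.aemeasurable F
  -- For non-measurable `F` the reverse inequality uses that `F` is almost contained in the
  -- `S`-preimage of a measurable hull of `T⁻¹ F`.
  · have hW := measurableSet_toMeasurable P.probMeasure (T ⁻¹' F)
    calc Q.probMeasure F ≤ Q.probMeasure (S ⁻¹' toMeasurable P.probMeasure (T ⁻¹' F)) := by
          refine measure_mono_ae ?_
          filter_upwards [ht.symm.ae_mem] with p ⟨hp, hSp⟩ hpF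
          refine subset_toMeasurable _ _ ?_
          rw [mem_preimage, ht.symm.right_left hp hSp]
          exact hpF
      _ = P.probMeasure (T ⁻¹' F) := by
          rw [← Measure.map_apply ht.right.measurable hW, ht.map_right, measure_toMeasurable]

theorem gradientImage_subset_boundary (P Q : WeightedNormals d) (f : (Fin (d + 1) → ℝ) → ℝ)
    (E : Set (Fin (d + 1) → ℝ)) : gradientImage P Q f E ⊆ Q.boundary := by
  rintro p ⟨x, -, hp⟩
  exact hp.1.1

theorem gradientImage_gradientImage (ht : IsTransport P Q f g X Y T S)
    {E : Set (Fin (d + 1) → ℝ)} (hE : E ⊆ P.boundary) :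
    gradientImage Q P g (gradientImage P Q f E) =ᵐ[P.probMeasure] E := by
  filter_upwards [ht.ae_mem] with x ⟨hx, hTx⟩
  refine propext ((ht.mem_gradientImage_iff (gradientImage_subset_boundary P Q f E) hx hTx).trans ?_)
  have hS : S (T x) ∈ X := by rw [ht.right_left hx hTx]; exact hx
  rw [ht.symm.mem_gradientImage_iff hE hTx hS, ht.right_left hx hTx]
  rfl

end IsTransport

/-- If a regular `p` is a gradient at `x`, then `x = S p`. Badness puts `x` on a face orthogonal to
`n`, whereas the gradient condition requires pairing one. -/
theorem measure_badSet_of_ae_mem_gradientImage (h : IsDualPair P Q) (hc : IsConjugatePair P Q f g)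
    (hY : IsGradientMap Q P g Y S)
    (hae : ∀ᵐ p ∂Q.probMeasure, p ∈ gradientImage P Q f P.boundary) :
    Q.probMeasure (badSet Q P g) = 0 := by
  rw [measure_eq_zero_iff_ae_notMem]
  filter_upwards [hae, measure_eq_zero_iff_ae_notMem.1 hY.measure_compl] with p hp hpY hbad
  rw [notMem_compl_iff] at hpY
  obtain ⟨x, hx, hpx⟩ := hp
  have hS := swap hc h hY hx hpx hpY
  obtain ⟨n, hn, hpn, m, hm, hnm, hSm⟩ := exists_face_of_mem_badSet h hY hpY hbad
  rw [hS] at hSm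
  obtain ⟨n', hn', h1, hpn'⟩ := hpx.2 m hm hSm
  obtain ⟨n'', -, -, huniq, -⟩ := hY.isRegularPoint p hpY
  rw [huniq n' hn' hpn', ← huniq n hn hpn, hnm] at h1
  exact zero_ne_one h1

end IsGradientMap

end WeightedNormals

/-! ### Subgradients and the Monge-Ampère equation on open faces. -/

section Subgradient

variable {d : ℕ}

/-- A subgradient of a convex function along a hyperplane extends to the whole space. -/
theorem exists_subgradient_extension {f : (Fin (d + 1) → ℝ) → ℝ} (hf : ConvexOn ℝ univ f)
    {m x q : Fin (d + 1) → ℝ} (hm : m ≠ 0)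
    (hq : ∀ y, (y - x) ⬝ᵥ m = 0 → f x + (y - x) ⬝ᵥ q ≤ f y) :
    ∃ s : ℝ, ∀ y, f x + (y - x) ⬝ᵥ (q + s • m) ≤ f y := by
  have hmm : 0 < m ⬝ᵥ m := lt_of_le_of_ne (by simpa using dotProduct_star_self_nonneg m)
    fun h => hm (dotProduct_self_eq_zero.1 h.symm)
  let k : (Fin (d + 1) → ℝ) → ℝ := fun y => f y - f x - (y - x) ⬝ᵥ q
  let r : (Fin (d + 1) → ℝ) → ℝ := fun y => (y - x) ⬝ᵥ m
  -- The slope `s` must lie above the quotients from one side of the hyperplane and below those from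
  -- the other. Convexity along a segment crossing the hyperplane orders the two sets, and `sSup A`
  -- separates them.
  let A : Set ℝ := {a | ∃ y, r y < 0 ∧ a = k y / r y}
  let B : Set ℝ := {b | ∃ y, 0 < r y ∧ b = k y / r y}
  have hAB : ∀ a ∈ A, ∀ b ∈ B, a ≤ b := by
    rintro _ ⟨y₂, hr₂, rfl⟩ _ ⟨y₁, hr₁, rfl⟩
    have hden : 0 < r y₁ - r y₂ := by linarith
    set l := -r y₂ / (r y₁ - r y₂) with hl
    set l' := r y₁ / (r y₁ - r y₂) with hl'
    have hsum : l + l' = 1 := by rw [hl, hl', ← add_div, div_eq_one_iff_eq hden.ne']; ring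
    have hl0 : 0 ≤ l := div_nonneg (by linarith) hden.le
    have hl0' : 0 ≤ l' := div_nonneg hr₁.le hden.le
    have hdec : l • y₁ + l' • y₂ - x = l • (y₁ - x) + l' • (y₂ - x) := by
      have : x = l • x + l' • x := by rw [← add_smul, hsum, one_smul]
      conv_lhs => rw [this]
      rw [smul_sub, smul_sub]; abel
    have hconv := hf.2 (mem_univ y₁) (mem_univ y₂) hl0 hl0' hsum
    have hr0 : (l • y₁ + l' • y₂ - x) ⬝ᵥ m = 0 := by
      rw [hdec, add_dotProduct, smul_dotProduct, smul_dotProduct]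
      change l * r y₁ + l' * r y₂ = 0
      rw [hl, hl']; field_simp; ring
    have h0 := hq _ hr0
    rw [hdec, add_dotProduct, smul_dotProduct, smul_dotProduct] at h0
    simp only [smul_eq_mul] at h0 hconv
    have hk : 0 ≤ l * k y₁ + l' * k y₂ := by
      have : l * k y₁ + l' * k y₂ = (l * f y₁ + l' * f y₂) - f x -
          (l * ((y₁ - x) ⬝ᵥ q) + l' * ((y₂ - x) ⬝ᵥ q)) := by
        simp only [k]; linear_combination (- f x) * hsum
      rw [this]; linarith
    have hk' : 0 ≤ -r y₂ * k y₁ + r y₁ * k y₂ := by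
      have : -r y₂ * k y₁ + r y₁ * k y₂ = (r y₁ - r y₂) * (l * k y₁ + l' * k y₂) := by
        rw [hl, hl']; field_simp
      rw [this]; exact mul_nonneg hden.le hk
    rw [div_le_iff_of_neg hr₂, div_mul_eq_mul_div, div_le_iff₀ hr₁]
    linarith
  have hrv : ∀ c : ℝ, r (x + c • m) = c * (m ⬝ᵥ m) := fun c => by simp [r, smul_dotProduct]
  have hA : A.Nonempty := ⟨_, x + (-1 : ℝ) • m, by rw [hrv]; linarith, rfl⟩
  have hB : B.Nonempty := ⟨_, x + (1 : ℝ) • m, by rw [hrv]; linarith, rfl⟩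
  obtain ⟨b₀, hb₀⟩ := hB
  have hbdd : BddAbove A := ⟨b₀, fun a ha => hAB a ha b₀ hb₀⟩
  refine ⟨sSup A, fun y => ?_⟩
  rw [dotProduct_add, dotProduct_smul, smul_eq_mul]
  rcases lt_trichotomy (r y) 0 with hlt | heq | hgt
  · have := le_csSup hbdd (show k y / r y ∈ A from ⟨y, hlt, rfl⟩)
    rw [div_le_iff_of_neg hlt] at this
    simp only [k, r] at this
    linarith
  · have := hq y heq
    change _ + (_ + sSup A * r y) ≤ _
    rw [heq]; linarith
  · have := csSup_le hA fun a ha => hAB a ha (k y / r y) ⟨y, hgt, rfl⟩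
    rw [le_div_iff₀ hgt] at this
    simp only [k, r] at this
    linarith

end Subgradient

namespace WeightedNormals

variable {d : ℕ} {P Q : WeightedNormals d} {f g : (Fin (d + 1) → ℝ) → ℝ}

theorem IsDualPair.chart_mem_openFace_iff (h : IsDualPair P Q) {m : Fin (d + 1) → ℝ}
    (hm : m ∈ P.normals) {t : CoordIndex m → ℝ} :
    P.chart m t ∈ P.openFace m ↔
      ∀ m' ∈ P.normals \ {m}, P.chart m t ⬝ᵥ m' < -P.weight m' := by
  have hdot := P.chart_dot (h.isPrimitive_left hm) t
  constructor
  · rintro ⟨hx, huniq⟩ m' ⟨hm', hne⟩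
    have hb := P.boundary_subset_body hx.1 m' hm'
    refine lt_of_le_of_ne (by linarith) fun he => hne (huniq m' hm' ⟨hx.1, he⟩)
  · intro hlt
    refine ⟨(h.mem_face_iff hm).2 ⟨fun m' hm' => ?_, hdot⟩, fun m' hm' hx => ?_⟩
    · by_cases he : m' = m
      · rw [he, hdot]; linarith
      · linarith [hlt m' ⟨hm', he⟩]
    · by_contra hne
      exact (hlt m' ⟨hm', hne⟩).ne hx.2

theorem chart_combination (P : WeightedNormals d) (m : Fin (d + 1) → ℝ) (s t : CoordIndex m → ℝ)
    {a b : ℝ} (hab : a + b = 1) :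
    P.chart m (a • s + b • t) = a • P.chart m s + b • P.chart m t := by
  rw [chart_sub P m (a • s + b • t), chart_sub P m s, chart_sub P m t]
  have hc : P.chart m 0 = a • P.chart m 0 + b • P.chart m 0 := by
    rw [← add_smul, hab, one_smul]
  conv_lhs => rw [hc]
  simp only [Pi.add_apply, Pi.smul_apply, smul_eq_mul, add_smul, mul_smul, Finset.sum_add_distrib,
    ← Finset.smul_sum, smul_add]
  abel

theorem IsDualPair.isOpen_openFace_coord (h : IsDualPair P Q) {m : Fin (d + 1) → ℝ}
    (hm : m ∈ P.normals) : IsOpen {t | P.chart m t ∈ P.openFace m} := by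
  have : {t | P.chart m t ∈ P.openFace m} =
      ⋂ m' ∈ P.normals \ {m}, {t | P.chart m t ⬝ᵥ m' < -P.weight m'} := by
    ext t; simp only [mem_ofPred_eq, h.chart_mem_openFace_iff hm, mem_iInter]
  rw [this]
  exact (h.finite_left.subset sdiff_subset).isOpen_biInter fun m' _ =>
    isOpen_lt ((continuous_dot m').comp (P.continuous_chart m)) continuous_const

theorem IsDualPair.convex_openFace_coord (h : IsDualPair P Q) {m : Fin (d + 1) → ℝ}
    (hm : m ∈ P.normals) : Convex ℝ {t | P.chart m t ∈ P.openFace m} := by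
  intro s hs t ht a b ha hb hab
  rw [mem_ofPred_eq, h.chart_mem_openFace_iff hm] at hs ht ⊢
  intro m' hm'
  have h1 := hs m' hm'
  have h2 := ht m' hm'
  rw [P.chart_combination m s t hab, add_dotProduct, smul_dotProduct, smul_dotProduct, smul_eq_mul,
    smul_eq_mul]
  have e : -P.weight m' = a * -P.weight m' + b * -P.weight m' := by rw [← add_mul, hab, one_mul]
  rw [e]
  rcases ha.eq_or_lt with rfl | ha'
  · have : b = 1 := by linarith
    subst this; linarith
  · nlinarith

theorem IsDualPair.lineProj_surjective (h : IsDualPair P Q) {m : Fin (d + 1) → ℝ}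
    (hm : m ∈ P.normals) (ξ : CoordIndex m → ℝ) : ∃ q, lineProj m q = ξ := by
  obtain ⟨n, hn, h1⟩ := h.exists_dot_eq_one_left m hm
  have hinj := pairingMap_injective (h.isPrimitive_left hm) (h.isPrimitive_right hn)
    (by rw [h1]; exact one_ne_zero)
  obtain ⟨z, zo, hz, hzo⟩ := h.isPrimitive_left hm
  obtain ⟨y, yo, hy, hyo⟩ := h.isPrimitive_right hn
  have hsurj := (LinearMap.injective_iff_surjective_of_finrank_eq_finrank (f := pairingMap m n)
    (by rw [Module.finrank_fintype_fun_eq_card, Module.finrank_fintype_fun_eq_card,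
          card_coordIndex hz hzo, card_coordIndex hy hyo])).1 hinj
  obtain ⟨t, rfl⟩ := hsurj ξ
  exact ⟨_, lineProj_sum m t⟩

namespace IsConjugatePair

/-- On an open face, the classical subgradients are the projections of the gradients. -/
theorem subgradientImage_eq (hc : IsConjugatePair P Q f g) (h : IsDualPair P Q)
    {m : Fin (d + 1) → ℝ} (hm : m ∈ P.normals) {A : Set (CoordIndex m → ℝ)}
    (hA : A ⊆ {t | P.chart m t ∈ P.openFace m}) :
    subgradientImage {t | P.chart m t ∈ P.openFace m} (fun t => f (P.chart m t)) A =
      lineProj m '' gradientImage P Q f (P.chart m '' A) := by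
  have hconv := hc.convexOn h
  ext ξ
  constructor
  · rintro ⟨t, ht, hsub⟩
    have htU := hA ht
    set x := P.chart m t with hx
    -- The subgradient inequality holds near `t` in the open face; convexity of `f` on the whole
    -- space spreads it over the entire hyperplane.
    have hglob : ∀ s, f x + ξ ⬝ᵥ (s - t) ≤ f (P.chart m s) := by
      intro s
      have hcont : Continuous fun c : ℝ => t + c • (s - t) := by fun_prop
      have hnear : ∀ᶠ c in nhds (0 : ℝ), t + c • (s - t) ∈ {t | P.chart m t ∈ P.openFace m} := by
        refine hcont.continuousAt.preimage_mem_nhds ((h.isOpen_openFace_coord hm).mem_nhds ?_)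
        simpa using htU
      obtain ⟨ε, hε, hb⟩ := Metric.eventually_nhds_iff.1 hnear
      set c := min (ε / 2) 1 with hcdef
      have hc0 : 0 < c := lt_min (by linarith) one_pos
      have hc1 : c ≤ 1 := min_le_right _ _
      have hcU := hb (y := c) (by
        rw [dist_zero_right, Real.norm_eq_abs, abs_of_pos hc0]
        exact (min_le_left _ _).trans_lt (by linarith))
      have h1 := hsub _ hcU
      have e : t + c • (s - t) = (1 - c) • t + c • s := by
        rw [smul_sub, sub_smul, one_smul]; abel
      have h2 := hconv.2 (mem_univ (P.chart m t)) (mem_univ (P.chart m s)) (sub_nonneg.2 hc1)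
        hc0.le (by ring)
      rw [← P.chart_combination m t s (by ring), ← e] at h2
      rw [add_sub_cancel_left, dotProduct_smul] at h1
      simp only [smul_eq_mul, ← hx] at h1 h2
      have h3 : c * (f x + ξ ⬝ᵥ (s - t)) ≤ c * f (P.chart m s) := by linarith
      exact le_of_mul_le_mul_left h3 hc0
    obtain ⟨q₀, hq₀⟩ := h.lineProj_surjective hm ξ
    have hprim := h.isPrimitive_left hm
    have hplane : ∀ y, (y - x) ⬝ᵥ m = 0 → f x + (y - x) ⬝ᵥ q₀ ≤ f y := by
      intro y hy
      have hxm : x ⬝ᵥ m = -P.weight m := P.chart_dot hprim t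
      obtain ⟨s, rfl⟩ := P.exists_chart_eq hprim (x := y) (by
        rw [sub_dotProduct, hxm] at hy; linarith)
      have := hglob s
      rw [sub_dotProduct, hx, P.chart_dot_eq m q₀ s, P.chart_dot_eq m q₀ t, hq₀]
      rw [hx, dotProduct_sub, dotProduct_comm ξ, dotProduct_comm ξ] at this
      linarith
    obtain ⟨c, hsg⟩ := exists_subgradient_extension hconv hprim.ne_zero hplane
    set q := q₀ + c • m with hq
    have hqξ : lineProj m q = ξ := by
      rw [← hq₀]; exact ((lineProj_eq_iff hprim).2 ⟨c, rfl⟩).symm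
    -- As `f` is a supremum over the boundary of `Q`, it grows at most by `-w n` when `x` moves by
    -- `n`; a global subgradient therefore satisfies the inequality of `n`.
    have hqb : q ∈ Q.body := by
      intro n hn
      have h1 := hsg (x + n)
      have h2 : f (x + n) ≤ f x - Q.weight n := by
        conv_lhs => rw [hc.eq_left]
        refine h.legendre_le fun p hp => ?_
        have h3 := hc.young h hp x
        have h4 := Q.boundary_subset_body hp n hn
        rw [dotProduct_add, dotProduct_comm p x]
        linarith
      rw [add_sub_cancel_left] at h1
      rw [dotProduct_comm]; linarith
    have hgq : g q + f x ≤ x ⬝ᵥ q := by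
      have : g q ≤ x ⬝ᵥ q - f x := by
        conv_lhs => rw [hc.eq_right]
        refine h.symm.legendre_le fun y _ => ?_
        have := hsg y
        rw [sub_dotProduct] at this
        linarith
      linarith
    -- The subgradient `q` may be interior to the body; pushing it along `m` to the exit keeps its
    -- projection and makes it a gradient.
    obtain ⟨p, hp, hpm, hpq⟩ := hc.exists_exit_conj h hm htU.1 hgq hqb
    refine ⟨p, ⟨x, mem_image_of_mem _ ht, hp, fun m' hm' hxm' => ?_⟩, by rw [hpq, hqξ]⟩
    rw [htU.2 m' hm' hxm']; exact hpm
  · rintro ⟨p, ⟨_, ⟨t, ht, rfl⟩, hp⟩, rfl⟩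
    refine ⟨t, ht, fun s _ => ?_⟩
    obtain ⟨hpb, he⟩ := hc.mem_conjugateSet.1 hp.1
    have h1 := hc.young h hpb (P.chart m s)
    rw [chart_dot_eq] at h1 he
    rw [dotProduct_sub, dotProduct_comm _ s, dotProduct_comm _ t]
    linarith

end IsConjugatePair

/-- A Borel set has Borel image under a continuous injection, and the remaining null part has null
image because the projection preserves measure. -/
theorem IsDualPair.nullMeasurableSet_lineProj_image (h : IsDualPair P Q) {m : Fin (d + 1) → ℝ}
    (hm : m ∈ P.normals) {G : Set (Fin (d + 1) → ℝ)} (hG : G ⊆ Q.posFaces m)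
    (hGm : NullMeasurableSet G Q.boundaryMeasure) :
    NullMeasurableSet (lineProj m '' G) volume := by
  obtain ⟨G₁, hG₁, hm₁, hae⟩ := hGm.exists_measurable_subset_ae_eq
  have hmeas : MeasurableSet (lineProj m '' G₁) := by
    refine hm₁.image_of_continuousOn_injOn (continuous_lineProj m).continuousOn ?_
    intro p hp q hq he
    obtain ⟨s, hs⟩ := (lineProj_eq_iff (h.isPrimitive_left hm)).1 he
    exact (IsDualPair.posFaces_unique m (hG (hG₁ hp)) (hG (hG₁ hq)) hs).symm
  have hnull : volume (lineProj m '' (G \ G₁)) = 0 := by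
    rw [h.volume_lineProj_image_posFaces hm (sdiff_subset.trans hG)]
    exact (ae_le_set.1 hae.symm.le)
  have : lineProj m '' G = lineProj m '' G₁ ∪ lineProj m '' (G \ G₁) := by
    rw [← image_union, union_sdiff_cancel hG₁]
  rw [this]
  exact hmeas.nullMeasurableSet.union (NullMeasurableSet.of_null hnull)

theorem IsGradientMap.IsTransport.solvesMongeAmpereOnFace {X Y : Set (Fin (d + 1) → ℝ)}
    {T S : (Fin (d + 1) → ℝ) → (Fin (d + 1) → ℝ)}
    (ht : IsGradientMap.IsTransport P Q f g X Y T S) {m : Fin (d + 1) → ℝ} (hm : m ∈ P.normals) :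
    P.SolvesMongeAmpereOnFace f (Q.boundaryMeasure univ / P.boundaryMeasure univ) m := by
  have h := ht.dual
  have hc := ht.conj
  refine ⟨h.isOpen_openFace_coord hm, ⟨h.convex_openFace_coord hm, ?_⟩, fun A hA hAm => ?_⟩
  · intro s _ t _ a b ha hb hab
    have := (hc.convexOn h).2 (mem_univ (P.chart m s)) (mem_univ (P.chart m t)) ha hb hab
    simp only
    rwa [P.chart_combination m s t hab]
  · rw [hc.subgradientImage_eq h hm hA]
    have hemb := (h.isClosedEmbedding_chart hm).measurableEmbedding
    have hAf : P.chart m '' A ⊆ P.face m := by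
      rintro _ ⟨t, ht', rfl⟩
      exact (hA ht').1
    have hAb : P.chart m '' A ⊆ P.boundary := fun x hx => (hAf hx).1
    have hG : gradientImage P Q f (P.chart m '' A) ⊆ Q.posFaces m := by
      rintro p ⟨x, hx, hp⟩
      exact hp.2 m hm (hAf hx)
    have hP0 := h.boundaryMeasure_univ_ne_zero
    have hPt := h.boundaryMeasure_univ_lt_top.ne
    have hQ0 := h.symm.boundaryMeasure_univ_ne_zero
    have hQt := h.symm.boundaryMeasure_univ_lt_top.ne
    have hnm := ht.symm.nullMeasurableSet_gradientImage hAb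
      (hemb.measurableSet_image.2 hAm).nullMeasurableSet
    refine ⟨h.nullMeasurableSet_lineProj_image hm hG (hnm.mono_ac ?_), ?_⟩
    · intro G hG0
      exact h.symm.probMeasure_eq_zero_iff.1 hG0
    · rw [h.volume_lineProj_image_posFaces hm hG]
      have hpm := ht.symm.measure_gradientImage hAb
      rw [IsDualPair.probMeasure_apply, IsDualPair.probMeasure_apply,
        h.boundaryMeasure_eq_faceMeasure hm hAf, h.faceMeasure_apply hm, inter_eq_left.2 hAf,
        hemb.injective.preimage_image] at hpm
      calc _ = Q.boundaryMeasure univ * ((Q.boundaryMeasure univ)⁻¹ *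
            Q.boundaryMeasure (gradientImage P Q f (P.chart m '' A))) := by
            rw [← mul_assoc, ENNReal.mul_inv_cancel hQ0 hQt, one_mul]
        _ = _ := by rw [hpm, div_eq_mul_inv, mul_assoc]

end WeightedNormals

/-! ### Reflexive polytopes yield dual pairs. -/

section Polytope

variable {d : ℕ}

theorem IsIntegralPolytope.vertices_finite {D : Set (Fin (d + 1) → ℝ)} (hD : IsIntegralPolytope D) :
    (vertices D).Finite := by
  obtain ⟨S, rfl⟩ := hD
  exact (S.finite_toSet.image _).subset extremePoints_convexHull_subset

theorem IsIntegralPolytope.vertices_integral {D : Set (Fin (d + 1) → ℝ)}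
    (hD : IsIntegralPolytope D) :
    ∀ m ∈ vertices D, ∃ z : Fin (d + 1) → ℤ, m = fun i => (z i : ℝ) := by
  obtain ⟨S, rfl⟩ := hD
  intro m hm
  obtain ⟨z, -, hz⟩ := extremePoints_convexHull_subset hm
  exact ⟨z, hz.symm⟩

theorem IsIntegralPolytope.isCompact {D : Set (Fin (d + 1) → ℝ)} (hD : IsIntegralPolytope D) :
    IsCompact D := by
  obtain ⟨S, rfl⟩ := hD
  exact (S.finite_toSet.image _).isCompact_convexHull ℝ

theorem IsIntegralPolytope.convex {D : Set (Fin (d + 1) → ℝ)} (hD : IsIntegralPolytope D) :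
    Convex ℝ D := by
  obtain ⟨S, rfl⟩ := hD
  exact convex_convexHull ℝ _

theorem IsIntegralPolytope.convexHull_vertices {D : Set (Fin (d + 1) → ℝ)}
    (hD : IsIntegralPolytope D) : convexHull ℝ (vertices D) = D := by
  have : closure (convexHull ℝ (vertices D)) = D :=
    closure_convexHull_extremePoints hD.isCompact hD.convex
  rwa [IsClosed.closure_eq (hD.vertices_finite.isCompact_convexHull ℝ).isClosed] at this

theorem dot_le_of_mem_convexHull {F : Set (Fin (d + 1) → ℝ)} {x p : Fin (d + 1) → ℝ} {c : ℝ}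
    (hF : ∀ v ∈ F, x ⬝ᵥ v ≤ c) (hp : p ∈ convexHull ℝ F) : x ⬝ᵥ p ≤ c := by
  have hconv : Convex ℝ {p : Fin (d + 1) → ℝ | x ⬝ᵥ p ≤ c} := by
    intro p hp q hq a b ha hb hab
    simp only [mem_ofPred_eq] at hp hq ⊢
    rw [dotProduct_add, dotProduct_smul, dotProduct_smul, smul_eq_mul, smul_eq_mul]
    have : c = a * c + b * c := by rw [← add_mul, hab, one_mul]
    nlinarith
  exact convexHull_min hF hconv hp

/-- An upper bound for `⟨x, ·⟩` on `F` passes to the hull, which contains small multiples of all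
`±e_i`. -/
theorem isBounded_of_zero_mem_interior {F : Set (Fin (d + 1) → ℝ)} (hF : F.Finite)
    (h0 : (0 : Fin (d + 1) → ℝ) ∈ interior (convexHull ℝ F)) (w : (Fin (d + 1) → ℝ) → ℝ) :
    Bornology.IsBounded {x : Fin (d + 1) → ℝ | ∀ v ∈ F, x ⬝ᵥ v + w v ≤ 0} := by
  obtain ⟨R, hR⟩ := (hF.image fun v => -w v).bddAbove
  have hR' : ∀ v ∈ F, -w v ≤ R := fun v hv => hR (mem_image_of_mem _ hv)
  obtain ⟨ε, hε, hball⟩ := Metric.mem_nhds_iff.1 (mem_interior_iff_mem_nhds.1 h0)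
  have hsingle : ∀ (i : Fin (d + 1)) (c : ℝ), |c| = ε / 2 →
      (Pi.single i c : Fin (d + 1) → ℝ) ∈ convexHull ℝ F := fun i c hc => hball (by
    rw [mem_ball_zero_iff, Pi.norm_single, Real.norm_eq_abs, hc]; linarith)
  refine isBounded_iff_forall_norm_le.2 ⟨2 * |R| / ε, fun x hx => ?_⟩
  have hx' : ∀ v ∈ F, x ⬝ᵥ v ≤ R := fun v hv => by linarith [hx v hv, hR' v hv]
  rw [pi_norm_le_iff_of_nonneg (by positivity)]
  intro i
  have h1 := dot_le_of_mem_convexHull hx' (hsingle i (ε / 2) (abs_of_pos (by linarith)))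
  have h2 := dot_le_of_mem_convexHull hx' (hsingle i (-(ε / 2)) (by
    rw [abs_neg, abs_of_pos (by linarith)]))
  rw [dotProduct_single] at h1 h2
  have hRR := le_abs_self R
  rw [Real.norm_eq_abs, le_div_iff₀ hε]
  rcases abs_cases (x i) with ⟨e, -⟩ | ⟨e, -⟩ <;> rw [e] <;> linarith

/-- A vertex of a polytope given by finitely many inequalities satisfies one of them sharply. -/
theorem exists_dot_eq_one_of_mem_vertices {F D : Set (Fin (d + 1) → ℝ)} (hF : F.Finite)
    (hD : D = {x | ∀ m ∈ F, m ⬝ᵥ x ≤ 1}) {n : Fin (d + 1) → ℝ} (hn : n ∈ vertices D) :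
    ∃ m ∈ F, m ⬝ᵥ n = 1 := by
  by_contra! hne
  have hlt : ∀ m ∈ F, m ⬝ᵥ n < 1 := fun m hm => by
    have := hn.1
    rw [hD] at this
    exact lt_of_le_of_ne (this m hm) (hne m hm)
  have hopen : IsOpen {x : Fin (d + 1) → ℝ | ∀ m ∈ F, m ⬝ᵥ x < 1} := by
    have : {x : Fin (d + 1) → ℝ | ∀ m ∈ F, m ⬝ᵥ x < 1} = ⋂ m ∈ F, {x | m ⬝ᵥ x < 1} := by
      ext x; simp
    rw [this]
    exact hF.isOpen_biInter fun m _ => isOpen_lt (by unfold dotProduct; fun_prop) continuous_const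
  obtain ⟨ε, hε, hball⟩ := Metric.isOpen_iff.1 hopen n hlt
  have hmem : ∀ c : ℝ, |c| = ε / 2 → n + Pi.single 0 c ∈ D := fun c hc => by
    have : n + Pi.single 0 c ∈ Metric.ball n ε := by
      rw [mem_ball_iff_norm, add_sub_cancel_left, Pi.norm_single, Real.norm_eq_abs, hc]; linarith
    rw [hD]
    exact fun m hm => (hball this m hm).le
  -- If all inequalities were strict, `n` would be the midpoint of a segment in `D`, against
  -- extremality.
  have hseg : n ∈ openSegment ℝ (n + Pi.single 0 (ε / 2)) (n + Pi.single 0 (-(ε / 2))) := by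
    refine ⟨1 / 2, 1 / 2, by norm_num, by norm_num, by norm_num, ?_⟩
    rw [Pi.single_neg, smul_add, smul_add, smul_neg]
    have : n = (1 / 2 : ℝ) • n + (1 / 2 : ℝ) • n := by rw [← add_smul]; norm_num
    conv_rhs => rw [this]
    abel
  have h1 := hn.2 (hmem (ε / 2) (abs_of_pos (by linarith)))
    (hmem (-(ε / 2)) (by rw [abs_neg, abs_of_pos (by linarith)])) hseg
  have h2 := congrFun h1 0
  simp at h2
  linarith

namespace IsReflexivePolytope

variable {D : Set (Fin (d + 1) → ℝ)}

theorem zero_mem_interior_dual (hD : IsReflexivePolytope D) :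
    (0 : Fin (d + 1) → ℝ) ∈ interior (dualPolytope D) := by
  have hopen : IsOpen {x : Fin (d + 1) → ℝ | ∀ m ∈ vertices D, m ⬝ᵥ x < 1} := by
    have : {x : Fin (d + 1) → ℝ | ∀ m ∈ vertices D, m ⬝ᵥ x < 1} =
        ⋂ m ∈ vertices D, {x | m ⬝ᵥ x < 1} := by
      ext x; simp
    rw [this]
    exact hD.integral.vertices_finite.isOpen_biInter fun m _ =>
      isOpen_lt (by unfold dotProduct; fun_prop) continuous_const
  exact mem_interior.2 ⟨_, fun x hx m hm => (hx m hm).le, hopen, fun m _ => by simp⟩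

/-- The bipolar theorem for reflexive polytopes. -/
theorem eq_setOf_dot_le (hD : IsReflexivePolytope D) :
    D = {p | ∀ n ∈ vertices (dualPolytope D), n ⬝ᵥ p ≤ 1} := by
  ext p
  constructor
  · intro hp n hn
    refine dot_le_of_mem_convexHull (fun m hm => ?_) (by rwa [hD.integral.convexHull_vertices])
    rw [dotProduct_comm]
    exact hn.1 m hm
  · intro hp
    by_contra hpD
    obtain ⟨ℓ, u, hlt, hgt⟩ := geometric_hahn_banach_closed_point hD.integral.convex
      hD.integral.isCompact.isClosed hpD
    have hu : 0 < u := by simpa using hlt 0 (interior_subset hD.zero_mem_interior)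
    -- The separating functional, rescaled so that it is at most one on `D`, is a point of the dual
    -- polytope that violates the inequality at `p`.
    let x : Fin (d + 1) → ℝ := fun i => u⁻¹ * ℓ (Pi.single i 1)
    have hx : ∀ y, y ⬝ᵥ x = u⁻¹ * ℓ y := by
      intro y
      have hy : ℓ y = ∑ i, y i * ℓ (Pi.single i 1) := by
        conv_lhs => rw [← Finset.univ_sum_single y, map_sum]
        refine Finset.sum_congr rfl fun i _ => ?_
        rw [← smul_eq_mul, ← map_smul, ← Pi.single_smul]; simp
      rw [hy, Finset.mul_sum]
      exact Finset.sum_congr rfl fun i _ => by simp only [x]; ring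
    have hxD : x ∈ dualPolytope D := fun m hm => by
      rw [hx, inv_mul_le_iff₀ hu, mul_one]; exact (hlt m hm.1).le
    rw [← hD.integral_dual.convexHull_vertices] at hxD
    have h1 : p ⬝ᵥ x ≤ 1 :=
      dot_le_of_mem_convexHull (fun n hn => by rw [dotProduct_comm]; exact hp n hn) hxD
    rw [hx, inv_mul_le_iff₀ hu, mul_one] at h1
    linarith

theorem isDualPair (hD : IsReflexivePolytope D) {lam mu : (Fin (d + 1) → ℝ) → ℝ}
    (hlam : ∀ m ∈ vertices D, lam m < 0) (hmu : ∀ n ∈ vertices (dualPolytope D), mu n < 0) :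
    WeightedNormals.IsDualPair (nSide D lam) (mSide D mu) where
  finite_left := hD.integral.vertices_finite
  finite_right := hD.integral_dual.vertices_finite
  integral_left := hD.integral.vertices_integral
  integral_right := hD.integral_dual.vertices_integral
  dot_le_one := fun m hm _ hn => hn.1 m hm
  exists_dot_eq_one_left := fun m hm => by
    obtain ⟨n, hn, h⟩ := exists_dot_eq_one_of_mem_vertices hD.integral_dual.vertices_finite
      hD.eq_setOf_dot_le hm
    exact ⟨n, hn, by rw [dotProduct_comm]; exact h⟩
  exists_dot_eq_one_right := fun _ hn =>
    exists_dot_eq_one_of_mem_vertices hD.integral.vertices_finite rfl hn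
  weight_neg_left := hlam
  weight_neg_right := hmu
  bounded_left := isBounded_of_zero_mem_interior hD.integral.vertices_finite
    (by rw [hD.integral.convexHull_vertices]; exact hD.zero_mem_interior) lam
  bounded_right := isBounded_of_zero_mem_interior hD.integral_dual.vertices_finite
    (by rw [hD.integral_dual.convexHull_vertices]; exact hD.zero_mem_interior_dual) mu
  nonempty_left := hD.integral.isCompact.extremePoints_nonempty
    ⟨0, interior_subset hD.zero_mem_interior⟩
  nonempty_right := hD.integral_dual.isCompact.extremePoints_nonempty
    ⟨0, interior_subset hD.zero_mem_interior_dual⟩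

end IsReflexivePolytope

end Polytope

/-! ### Invariance under change of representative, and the main theorem. -/

theorem IsAlexandrovSolution.congr {ι : Type} [Fintype ι] {U : Set (ι → ℝ)} {u u' : (ι → ℝ) → ℝ}
    {c : ENNReal} (hu : IsAlexandrovSolution U u c) (he : ∀ t ∈ U, u t = u' t) :
    IsAlexandrovSolution U u' c := by
  obtain ⟨hU, hconv, hMA⟩ := hu
  refine ⟨hU, hconv.congr he, fun A hA hAm => ?_⟩
  have : subgradientImage U u' A = subgradientImage U u A := by
    ext ξ
    refine exists_congr fun t => and_congr_right fun ht => forall₂_congr fun s hs => ?_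
    rw [he t (hA ht), he s hs]
  rw [this]
  exact hMA A hA hAm

namespace WeightedNormals

variable {d : ℕ} {P Q : WeightedNormals d} {φ f : (Fin (d + 1) → ℝ) → ℝ}

theorem gradientSet_congr (he : ∀ x ∈ P.boundary, φ x = f x) {x : Fin (d + 1) → ℝ}
    (hx : x ∈ P.boundary) : gradientSet P Q φ x = gradientSet P Q f x := by
  rw [gradientSet, gradientSet, conjugateSet, conjugateSet, legendre_congr he, he x hx]

theorem gradientImage_congr (he : ∀ x ∈ P.boundary, φ x = f x) {E : Set (Fin (d + 1) → ℝ)}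
    (hE : E ⊆ P.boundary) : gradientImage P Q φ E = gradientImage P Q f E := by
  ext p
  refine exists_congr fun x => and_congr_right fun hx => ?_
  rw [gradientSet_congr he (hE hx)]

theorem badSet_congr (he : ∀ x ∈ P.boundary, φ x = f x) : badSet P Q φ = badSet P Q f := by
  ext x
  refine exists_congr fun m => and_congr_right fun _ => and_congr_right fun hx => ?_
  rw [gradientSet_congr he hx.1, conjugateSet, conjugateSet, legendre_congr he, he x hx.1]

end WeightedNormals

theorem theorem2p20 (d : ℕ) (D : Set (Fin (d + 1) → ℝ)) (hD : IsReflexivePolytope D)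
    (lam mu : (Fin (d + 1) → ℝ) → ℝ)
    (hlam : ∀ m ∈ vertices D, lam m < 0)
    (hmu : ∀ n ∈ vertices (dualPolytope D), mu n < 0)
    (P Q : WeightedNormals d) (hP : P = nSide D lam) (hQ : Q = mSide D mu)
    (φ φstar : (Fin (d + 1) → ℝ) → ℝ)
    (hφ : WeightedNormals.IsMinimizer P Q φ)
    (hφstar : φstar = P.legendre φ) :
    -- the equivalent conditions: |B| = 0; |B^∨| = 0; both gradient images have full measure
    List.TFAE
      [Q.probMeasure (WeightedNormals.badSet Q P φstar) = 0,
       P.probMeasure (WeightedNormals.badSet P Q φ) = 0,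
       (∀ᵐ p ∂Q.probMeasure, p ∈ WeightedNormals.gradientImage P Q φ P.boundary) ∧
         (∀ᵐ x ∂P.probMeasure, x ∈ WeightedNormals.gradientImage Q P φstar Q.boundary)] ∧
    -- they hold if the pairing of vertices never vanishes
    ((∀ m ∈ vertices D, ∀ n ∈ vertices (dualPolytope D), m ⬝ᵥ n ≠ 0) →
      Q.probMeasure (WeightedNormals.badSet Q P φstar) = 0) ∧
    -- consequences
    (Q.probMeasure (WeightedNormals.badSet Q P φstar) = 0 →
      -- the gradients preserve measure
      (∀ E ⊆ P.boundary,
        (NullMeasurableSet E P.probMeasure →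
          NullMeasurableSet (WeightedNormals.gradientImage P Q φ E) Q.probMeasure) ∧
        Q.probMeasure (WeightedNormals.gradientImage P Q φ E) = P.probMeasure E) ∧
      (∀ F ⊆ Q.boundary,
        (NullMeasurableSet F Q.probMeasure →
          NullMeasurableSet (WeightedNormals.gradientImage Q P φstar F) P.probMeasure) ∧
        P.probMeasure (WeightedNormals.gradientImage Q P φstar F) = Q.probMeasure F) ∧
      -- they are almost everywhere single valued and inverse to each other
      (∀ᵐ x ∂P.probMeasure, ∃ p, WeightedNormals.gradientSet P Q φ x = {p} ∧
        WeightedNormals.gradientSet Q P φstar p = {x}) ∧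
      (∀ᵐ p ∂Q.probMeasure, ∃ x, WeightedNormals.gradientSet Q P φstar p = {x} ∧
        WeightedNormals.gradientSet P Q φ x = {p}) ∧
      (∀ E ⊆ P.boundary, WeightedNormals.gradientImage Q P φstar
        (WeightedNormals.gradientImage P Q φ E) =ᵐ[P.probMeasure] E) ∧
      (∀ F ⊆ Q.boundary, WeightedNormals.gradientImage P Q φ
        (WeightedNormals.gradientImage Q P φstar F) =ᵐ[Q.probMeasure] F) ∧
      -- the real Monge-Ampère equations on the open faces
      (∀ m ∈ P.normals, P.SolvesMongeAmpereOnFace φ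
        (Q.boundaryMeasure univ / P.boundaryMeasure univ) m) ∧
      (∀ n ∈ Q.normals, Q.SolvesMongeAmpereOnFace φstar
        (P.boundaryMeasure univ / Q.boundaryMeasure univ) n)) := by
  subst hP hQ hφstar
  have h := hD.isDualPair hlam hmu
  set P := nSide D lam
  set Q := mSide D mu
  have hc := h.isConjugatePair_of_isGlobalConvex hφ.1
  have he := h.legendre_legendre_eq hφ.1
  set g := P.legendre φ
  -- Only the boundary values of `φ` matter, and there it agrees with `f`, which is convex on the
  -- whole space.
  set f := Q.legendre g
  have hmin : WeightedNormals.IsMinimizer P Q f :=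
    ⟨WeightedNormals.isGlobalConvex_congr he hφ.1, fun φ' hφ' => by
      rw [← h.functional_congr he]; exact hφ.2 φ' hφ'⟩
  have hmin' := hc.isMinimizer_symm h hmin
  obtain ⟨X, T, hX₁, hX₂, hX₃, hX₄⟩ := hc.exists_gradientMap h
  obtain ⟨Y, S, hY₁, hY₂, hY₃, hY₄⟩ := hc.symm.exists_gradientMap h.symm
  have hX : WeightedNormals.IsGradientMap P Q f X T :=
    ⟨hX₁, hX₂, hX₃, fun x hx => (hX₄ x hx).1, fun x hx => (hX₄ x hx).2⟩
  have hY : WeightedNormals.IsGradientMap Q P g Y S :=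
    ⟨hY₁, hY₂, hY₃, fun x hx => (hY₄ x hx).1, fun x hx => (hY₄ x hx).2⟩
  have htr : Q.probMeasure (WeightedNormals.badSet Q P g) = 0 →
      WeightedNormals.IsGradientMap.IsTransport P Q f g X Y T S := fun hbad =>
    WeightedNormals.IsGradientMap.isTransport_of_map_eq h hc hX hY
      (WeightedNormals.IsGradientMap.map_eq hc h hX hY hmin hbad)
  have htr' : P.probMeasure (WeightedNormals.badSet P Q f) = 0 →
      WeightedNormals.IsGradientMap.IsTransport P Q f g X Y T S := fun hbad =>
    (WeightedNormals.IsGradientMap.isTransport_of_map_eq h.symm hc.symm hY hX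
      (WeightedNormals.IsGradientMap.map_eq hc.symm h.symm hY hX hmin' hbad)).symm
  rw [WeightedNormals.badSet_congr (Q := Q) he]
  refine ⟨?_, fun hne => ?_, fun hbad => ?_⟩
  · rw [WeightedNormals.gradientImage_congr (Q := Q) he subset_rfl]
    tfae_have 1 → 2 := fun hbad => (htr hbad).measure_badSet
    tfae_have 2 → 3 := fun hbad =>
      ⟨(htr' hbad).symm.ae_mem_gradientImage, (htr' hbad).ae_mem_gradientImage⟩
    tfae_have 3 → 1 := fun hae =>
      WeightedNormals.IsGradientMap.measure_badSet_of_ae_mem_gradientImage h hc hY hae.1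
    tfae_finish
  · convert measure_empty (μ := Q.probMeasure)
    rw [eq_empty_iff_forall_notMem]
    rintro p ⟨n, hn, -, m, hm, hnm, -⟩
    exact hne m hm n hn (by rw [dotProduct_comm]; exact hnm)
  · have ht := htr hbad
    refine ⟨fun E hE => ?_, fun F hF =>
      ⟨ht.nullMeasurableSet_gradientImage hF, ht.measure_gradientImage hF⟩, ?_, ?_, fun E hE => ?_,
      fun F hF => ?_, fun m hm => ?_, fun n hn => ht.symm.solvesMongeAmpereOnFace hn⟩
    · rw [WeightedNormals.gradientImage_congr he hE]
      exact ⟨ht.symm.nullMeasurableSet_gradientImage hE, ht.symm.measure_gradientImage hE⟩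
    · filter_upwards [ht.ae_gradientSet, h.ae_mem_boundary] with x hx hxb
      rwa [WeightedNormals.gradientSet_congr he hxb]
    · filter_upwards [ht.symm.ae_gradientSet] with p ⟨x, hpx, hxp⟩
      have hxb : x ∈ P.boundary := by
        have : x ∈ WeightedNormals.gradientSet Q P g p := by rw [hpx]; rfl
        exact this.1.1
      exact ⟨x, hpx, by rw [WeightedNormals.gradientSet_congr he hxb]; exact hxp⟩
    · rw [WeightedNormals.gradientImage_congr he hE]
      exact ht.gradientImage_gradientImage hE
    · rw [WeightedNormals.gradientImage_congr he
        (WeightedNormals.IsGradientMap.IsTransport.gradientImage_subset_boundary Q P g F)]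
      exact ht.symm.gradientImage_gradientImage hF
    · exact (ht.solvesMongeAmpereOnFace hm).congr fun t htU => (he _ htU.1.1).symm
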